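/- Let $(X,\mathcal B,\mu)$ be a standard (non-atomic) probability space and let $Aut$ be the group of its automorphisms, i.e. of the invertible $\mu$-preserving transformations of $X$, considered up to equality $\mu$-almost everywhere. Let $(A_i)_{i\ge 0}$ be a sequence of measurable sets that is dense in $\mathcal B$ (with respect to the distance $\mu(B\,\Delta\,C)$), and equip $Aut$ with the Halmos metric $$\rho(S,T)=\sum_{i} 2^{-i}\bigl(\mu(SA_i\,\Delta\, TA_i)+\mu(S^{-1}A_i\,\Delta\, T^{-1}A_i)\bigr).$$ Let $L(j)$ be a sequence of natural numbers with $L(j)\to\infty$, and let $P_j=\{j,2j,\dots,L(j)j\}$. For $S\in Aut$ define $$h_P(S)=\sup_\xi\ \limsup_{j\to\infty}\ \frac1{|P_j|}\,H\Bigl(\bigvee_{p\in P_j}S^p\xi\Bigr),$$ where the supremum is over all finite measurable partitions $\xi$ of $X$, $S^p\xi$ is the partition into the images under $S^p$ of the cells of $\xi$, and $H(\{C_1,\dots,C_n\})=-\sum_{i=1}^n\mu(C_i)\ln\mu(C_i)$ (with $0\ln 0=0$). Then the set $\{S\in Aut : h_P(S)=\infty\}$ is generic, i.e. it contains a $G_\delta$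 set that is dense in $(Aut,\rho)$. -/

import Mathlib

open MeasureTheory Filter Topology Set
open scoped symmDiff

noncomputable section

namespace KushnirenkoEntropy

variable {X : Type*} [MeasurableSpace X]

/-! ### The group of automorphisms of a measure space -/

/-- Invertible transformations of `X` that preserve `μ` together with their inverses
(measurability of both maps is part of `MeasurePreserving`). -/
def mpGroup (μ : Measure X) : Subgroup (Equiv.Perm X) where
  carrier := {S | MeasurePreserving S μ μ ∧ MeasurePreserving S.symm μ μ}
  mul_mem' := fun {_ _} hS hT => ⟨hS.1.comp hT.1, hT.2.comp hS.2⟩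
  one_mem' := ⟨MeasurePreserving.id μ, MeasurePreserving.id μ⟩
  inv_mem' := fun {_} hS => ⟨hS.2, hS.1⟩

theorem mpGroup.measurePreserving {μ : Measure X} (S : mpGroup μ) :
    MeasurePreserving (S : Equiv.Perm X) μ μ := S.2.1

/-- The transformations that are equal to the identity almost everywhere. -/
def nullGroup (μ : Measure X) : Subgroup (mpGroup μ) where
  carrier := {S | ∀ᵐ x ∂μ, (S : Equiv.Perm X) x = x}
  mul_mem' := by
    intro S T hS hT
    simp only [Set.mem_ofPred_eq] at hS hT ⊢
    filter_upwards [hS, hT] with x hxS hxT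
    simp [Equiv.Perm.mul_apply, hxT, hxS]
  one_mem' := by simp
  inv_mem' := by
    intro S hS
    simp only [Set.mem_ofPred_eq] at hS ⊢
    filter_upwards [hS] with x hx
    rw [Subgroup.coe_inv, Equiv.Perm.inv_eq_iff_eq, hx]

instance nullGroup_normal (μ : Measure X) : (nullGroup μ).Normal where
  conj_mem := by
    intro N hN T
    have hN' : ∀ᵐ x ∂μ, (N : Equiv.Perm X) x = x := hN
    have h := (mpGroup.measurePreserving T⁻¹).quasiMeasurePreserving.ae hN'
    change ∀ᵐ x ∂μ, ((T * N * T⁻¹ : mpGroup μ) : Equiv.Perm X) x = x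
    filter_upwards [h] with x hx
    simp only [Subgroup.coe_mul, Equiv.Perm.mul_apply, hx]
    simp

/-- The group `Aut` of automorphisms of `(X, μ)`: invertible measure-preserving transformations,
two of them being identified when they are equal almost everywhere. -/
abbrev Aut (μ : Measure X) : Type _ := mpGroup μ ⧸ nullGroup μ

/-- Representatives of the same automorphism move every set to the same set modulo `μ`. -/
theorem image_ae_eq {μ : Measure X} {S T : mpGroup μ} (h : (S : Aut μ) = (T : Aut μ))
    (C : Set X) : ((S : Equiv.Perm X) '' C : Set X) =ᵐ[μ] ((T : Equiv.Perm X) '' C : Set X) := by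
  have h1 : ((S⁻¹ : mpGroup μ) : Aut μ) = ((T⁻¹ : mpGroup μ) : Aut μ) := by
    rw [QuotientGroup.mk_inv, QuotientGroup.mk_inv, h]
  have h2 : ∀ᵐ x ∂μ, (((S⁻¹)⁻¹ * T⁻¹ : mpGroup μ) : Equiv.Perm X) x = x := QuotientGroup.eq.1 h1
  rw [eventuallyEq_set]
  filter_upwards [h2] with x hx
  have hx' : (S : Equiv.Perm X) ((T : Equiv.Perm X).symm x) = x := by
    simpa [Equiv.Perm.mul_apply] using hx
  rw [Equiv.image_eq_preimage_symm, Equiv.image_eq_preimage_symm, Set.mem_preimage,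
    Set.mem_preimage, (Equiv.symm_apply_eq _).2 hx'.symm]

/-! ### The Halmos metric -/

/-- The number `μ(S A ∆ T A)`. -/
def imageDist (μ : Measure X) (A : Set X) (S T : Aut μ) : ℝ :=
  Quotient.liftOn₂ S T
    (fun S T => μ.real (((S : Equiv.Perm X) '' A) ∆ ((T : Equiv.Perm X) '' A)))
    (fun _ _ _ _ h₁ h₂ => measureReal_congr
      (ae_eq_set_symmDiff (image_ae_eq (Quotient.sound h₁) A) (image_ae_eq (Quotient.sound h₂) A)))

/-- The Halmos distance
`ρ(S, T) = ∑ i, 2⁻ⁱ (μ(S Aᵢ ∆ T Aᵢ) + μ(S⁻¹ Aᵢ ∆ T⁻¹ Aᵢ))` built on a sequence of sets. -/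
def halmosDist (μ : Measure X) (A : ℕ → Set X) (S T : Aut μ) : ℝ :=
  ∑' i, (1 / 2 : ℝ) ^ i * (imageDist μ (A i) S T + imageDist μ (A i) S⁻¹ T⁻¹)

/-- The sequence `A` of measurable sets is dense in the σ-algebra of measurable sets, with respect
to the distance `μ(B ∆ C)`. -/
structure IsDenseSeq (μ : Measure X) (A : ℕ → Set X) : Prop where
  measurableSet (i : ℕ) : MeasurableSet (A i)
  exists_lt (B : Set X) (hB : MeasurableSet B) (ε : ℝ) (hε : 0 < ε) : ∃ i, μ.real (A i ∆ B) < ε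

theorem imageDist_nonneg (μ : Measure X) (A : Set X) (S T : Aut μ) : 0 ≤ imageDist μ A S T := by
  induction S, T using Quotient.inductionOn₂
  exact measureReal_nonneg

theorem imageDist_self (μ : Measure X) (A : Set X) (S : Aut μ) : imageDist μ A S S = 0 := by
  induction S using Quotient.inductionOn
  simp [imageDist]

theorem imageDist_comm (μ : Measure X) (A : Set X) (S T : Aut μ) :
    imageDist μ A S T = imageDist μ A T S := by
  induction S, T using Quotient.inductionOn₂
  simp [imageDist, symmDiff_comm]

theorem imageDist_triangle (μ : Measure X) [IsFiniteMeasure μ] (A : Set X) (S T U : Aut μ) :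
    imageDist μ A S U ≤ imageDist μ A S T + imageDist μ A T U := by
  induction S, T using Quotient.inductionOn₂
  induction U using Quotient.inductionOn
  exact measureReal_symmDiff_le _

theorem imageDist_le (μ : Measure X) [IsFiniteMeasure μ] (A : Set X) (S T : Aut μ) :
    imageDist μ A S T ≤ μ.real univ := by
  induction S, T using Quotient.inductionOn₂
  exact measureReal_mono (subset_univ _)

theorem summable_halmos (μ : Measure X) [IsFiniteMeasure μ] (A : ℕ → Set X) (S T : Aut μ) :
    Summable fun i =>
      (1 / 2 : ℝ) ^ i * (imageDist μ (A i) S T + imageDist μ (A i) S⁻¹ T⁻¹) := by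
  refine Summable.of_nonneg_of_le (fun i => ?_) (fun i => ?_)
    (summable_geometric_two.mul_right (μ.real univ + μ.real univ))
  · have := imageDist_nonneg μ (A i) S T
    have := imageDist_nonneg μ (A i) S⁻¹ T⁻¹
    positivity
  · exact mul_le_mul_of_nonneg_left
      (add_le_add (imageDist_le _ _ _ _) (imageDist_le _ _ _ _)) (by positivity)

theorem measureReal_image (μ : Measure X) (S : mpGroup μ) {B : Set X} (hB : MeasurableSet B) :
    μ.real ((S : Equiv.Perm X) '' B) = μ.real B := by
  rw [Equiv.image_eq_preimage_symm, Measure.real, Measure.real,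
    S.2.2.measure_preimage hB.nullMeasurableSet]

theorem eq_of_imageDist_eq_zero (μ : Measure X) [IsFiniteMeasure μ] [StandardBorelSpace X]
    {A : ℕ → Set X} (hA : IsDenseSeq μ A) {S T : Aut μ}
    (h : ∀ i, imageDist μ (A i) S T = 0) : S = T := by
  have hall : ∀ B, MeasurableSet B → imageDist μ B S T = 0 := by
    intro B hB
    refine le_antisymm (le_of_forall_pos_le_add fun ε hε => ?_) (imageDist_nonneg _ _ _ _)
    obtain ⟨i, hi⟩ := hA.exists_lt B hB (ε / 2) (by positivity)
    have hi0 := h i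
    induction S, T using Quotient.inductionOn₂ with | _ S T
    change μ.real (((S : Equiv.Perm X) '' (A i)) ∆ ((T : Equiv.Perm X) '' (A i))) = 0 at hi0
    change μ.real (((S : Equiv.Perm X) '' B) ∆ ((T : Equiv.Perm X) '' B)) ≤ 0 + ε
    have hm : MeasurableSet (A i ∆ B) := (hA.measurableSet i).symmDiff hB
    have e1 : μ.real (((S : Equiv.Perm X) '' B) ∆ ((S : Equiv.Perm X) '' A i)) < ε / 2 := by
      rw [← Set.image_symmDiff (S : Equiv.Perm X).injective, symmDiff_comm,
        measureReal_image μ S hm]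
      exact hi
    have e2 : μ.real (((T : Equiv.Perm X) '' A i) ∆ ((T : Equiv.Perm X) '' B)) < ε / 2 := by
      rw [← Set.image_symmDiff (T : Equiv.Perm X).injective, measureReal_image μ T hm]
      exact hi
    have t1 := measureReal_symmDiff_le (μ := μ) (s := (S : Equiv.Perm X) '' B)
      (t := (S : Equiv.Perm X) '' A i) ((T : Equiv.Perm X) '' B)
    have t2 := measureReal_symmDiff_le (μ := μ) (s := (S : Equiv.Perm X) '' A i)
      (t := (T : Equiv.Perm X) '' A i) ((T : Equiv.Perm X) '' B)
    linarith
  rw [← inv_inj]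
  induction S, T using Quotient.inductionOn₂ with | _ S T
  have key : ((S : Equiv.Perm X).symm : X → X) =ᵐ[μ] (T : Equiv.Perm X).symm := by
    refine Filter.EventuallyEq.of_forall_separating_preimage (p := MeasurableSet) ?_
    intro B hB
    have := hall B hB
    change μ.real (((S : Equiv.Perm X) '' B) ∆ ((T : Equiv.Perm X) '' B)) = 0 at this
    rw [measureReal_eq_zero_iff, measure_symmDiff_eq_zero_iff, Equiv.image_eq_preimage_symm,
      Equiv.image_eq_preimage_symm] at this
    exact this
  change ((S⁻¹ : mpGroup μ) : Aut μ) = ((T⁻¹ : mpGroup μ) : Aut μ)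
  refine QuotientGroup.eq.2 ?_
  change ∀ᵐ x ∂μ, (((S⁻¹)⁻¹ * T⁻¹ : mpGroup μ) : Equiv.Perm X) x = x
  filter_upwards [key] with x hx
  have : (S : Equiv.Perm X) ((T : Equiv.Perm X).symm x) = x := by rw [← hx]; simp
  simpa [Equiv.Perm.mul_apply] using this

/-- The Halmos metric on `Aut` that is built on a dense sequence of measurable sets. -/
@[reducible]
def halmosMetric (μ : Measure X) [IsFiniteMeasure μ] [StandardBorelSpace X] (A : ℕ → Set X)
    (hA : IsDenseSeq μ A) : MetricSpace (Aut μ) where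
  dist := halmosDist μ A
  dist_self S := by simp [halmosDist, imageDist_self]
  dist_comm S T := by
    simp only [halmosDist]
    refine tsum_congr fun i => ?_
    rw [imageDist_comm, imageDist_comm μ (A i) S⁻¹]
  dist_triangle S T U := by
    simp only [halmosDist]
    rw [← (summable_halmos μ A S T).tsum_add (summable_halmos μ A T U)]
    refine (summable_halmos μ A S U).tsum_le_tsum (fun i => ?_)
      ((summable_halmos μ A S T).add (summable_halmos μ A T U))
    rw [← mul_add]
    refine mul_le_mul_of_nonneg_left ?_ (by positivity)
    have := imageDist_triangle μ (A i) S T U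
    have := imageDist_triangle μ (A i) S⁻¹ T⁻¹ U⁻¹
    linarith
  eq_of_dist_eq_zero := by
    intro S T h
    refine eq_of_imageDist_eq_zero μ hA fun i => ?_
    have hn : ∀ i, 0 ≤ imageDist μ (A i) S T + imageDist μ (A i) S⁻¹ T⁻¹ := fun i =>
      add_nonneg (imageDist_nonneg _ _ _ _) (imageDist_nonneg _ _ _ _)
    have hle := (summable_halmos μ A S T).le_tsum i
      (fun j _ => mul_nonneg (by positivity) (hn j))
    have h0 : ∑' i, (1 / 2 : ℝ) ^ i * (imageDist μ (A i) S T + imageDist μ (A i) S⁻¹ T⁻¹) = 0 := h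
    rw [h0] at hle
    have hpos : (0 : ℝ) < (1 / 2 : ℝ) ^ i := by positivity
    have h1 : imageDist μ (A i) S T + imageDist μ (A i) S⁻¹ T⁻¹ ≤ 0 := by
      by_contra hc
      push Not at hc
      exact absurd hle (not_le.2 (mul_pos hpos hc))
    have h2 := imageDist_nonneg μ (A i) S T
    have h3 := imageDist_nonneg μ (A i) S⁻¹ T⁻¹
    linarith

/-- A set is generic if it contains a dense `G_δ` set. -/
def IsGeneric {Y : Type*} [TopologicalSpace Y] (s : Set Y) : Prop :=
  ∃ W ⊆ s, IsGδ W ∧ Dense W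

/-! ### Partitions and entropy -/

/-- A measurable partition of `X` with cells indexed by `ι` (empty cells are allowed). -/
structure MeasPartition (X : Type*) [MeasurableSpace X] (ι : Type*) where
  cell : ι → Set X
  measurableSet_cell (i : ι) : MeasurableSet (cell i)
  disjoint : Pairwise fun i j => Disjoint (cell i) (cell j)
  iUnion_cell : ⋃ i, cell i = univ

/-- The partition `S ξ`, with cells `S C` for the cells `C` of `ξ`. -/
def MeasPartition.image {ι : Type*} {μ : Measure X} (S : mpGroup μ) (ξ : MeasPartition X ι) :
    MeasPartition X ι where
  cell i := (S : Equiv.Perm X) '' ξ.cell i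
  measurableSet_cell i := by
    rw [Equiv.image_eq_preimage_symm]
    exact S.2.2.measurable (ξ.measurableSet_cell i)
  disjoint i j hij := (Set.disjoint_image_iff (S : Equiv.Perm X).injective).2 (ξ.disjoint hij)
  iUnion_cell := by
    rw [← Set.image_iUnion, ξ.iUnion_cell, Set.image_univ, (S : Equiv.Perm X).range_eq_univ]

/-- The join `⋁ k, η k` of a finite family of partitions: its cells are the intersections of one
cell from each of them. -/
def MeasPartition.join {ι κ : Type*} [Finite κ] (η : κ → MeasPartition X ι) :
    MeasPartition X (κ → ι) where
  cell a := ⋂ k, (η k).cell (a k)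
  measurableSet_cell a := MeasurableSet.iInter fun k => (η k).measurableSet_cell (a k)
  disjoint a b hab := by
    obtain ⟨k, hk⟩ := Function.ne_iff.1 hab
    exact ((η k).disjoint hk).mono (Set.iInter_subset _ k) (Set.iInter_subset _ k)
  iUnion_cell := by
    refine Set.eq_univ_of_forall fun x => ?_
    have h : ∀ k, ∃ i, x ∈ (η k).cell i := fun k => by
      rw [← Set.mem_iUnion, (η k).iUnion_cell]; trivial
    choose a ha using h
    exact Set.mem_iUnion.2 ⟨a, Set.mem_iInter.2 ha⟩

/-- The entropy `H(ξ) = -∑ i, μ(Cᵢ) ln μ(Cᵢ)` of a finite partition, with `0 ln 0 = 0`. -/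
def MeasPartition.entropy {ι : Type*} [Fintype ι] (μ : Measure X) (ξ : MeasPartition X ι) : ℝ :=
  -∑ i, μ.real (ξ.cell i) * Real.log (μ.real (ξ.cell i))

/-- `h(S, ξ) = |F|⁻¹ H(⋁_{p ∈ F} S^p ξ)` for a finite set `F` of integers. -/
def meanEntropy (μ : Measure X) (F : Finset ℤ) {n : ℕ} (ξ : MeasPartition X (Fin n))
    (S : Aut μ) : ℝ :=
  Quotient.liftOn S
    (fun S => (1 / (F.card : ℝ)) *
      (MeasPartition.join fun p : F => ξ.image (S ^ (p : ℤ))).entropy μ)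
    (by
      intro S T h
      have hST : (S : Aut μ) = (T : Aut μ) := Quotient.sound h
      have hpow (p : ℤ) : ((S ^ p : mpGroup μ) : Aut μ) = ((T ^ p : mpGroup μ) : Aut μ) := by
        rw [QuotientGroup.mk_zpow, QuotientGroup.mk_zpow, hST]
      have hcell (a : F → Fin n) :
          μ.real ((MeasPartition.join fun p : F => ξ.image (S ^ (p : ℤ))).cell a) =
            μ.real ((MeasPartition.join fun p : F => ξ.image (T ^ (p : ℤ))).cell a) :=
        measureReal_congr (Filter.EventuallyEq.countable_iInter fun p => image_ae_eq (hpow p) _)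
      simp only [MeasPartition.entropy, hcell])

/-- The entropy `h_P(S) = sup_ξ limsup_j |P_j|⁻¹ H(⋁_{p ∈ P_j} S^p ξ)` along a sequence `P` of
finite sets of integers; the supremum is over all finite measurable partitions. -/
def pEntropy (μ : Measure X) (P : ℕ → Finset ℤ) (S : Aut μ) : EReal :=
  ⨆ (n : ℕ) (ξ : MeasPartition X (Fin n)),
    limsup (fun j => (meanEntropy μ (P j) ξ S : EReal)) atTop

/-- The progressions `P_j = {j, 2j, …, L(j) j}`. -/
def progression (L : ℕ → ℕ) (j : ℕ) : Finset ℤ :=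
  (Finset.Icc 1 (L j)).image fun k : ℕ => (k : ℤ) * (j : ℤ)

end KushnirenkoEntropy

end

noncomputable section

namespace KushnirenkoEntropy

/-! ### Isomorphism of non-atomic standard probability spaces -/

section Isomorphism

variable {X Y : Type*} [MeasurableSpace X] [MeasurableSpace Y]

/-! Fix an equipartition `ξ` into `n` cells with `ln n > c`. The automorphisms whose mean entropy
along some `P_j`, `j ≥ N`, exceeds `c` form an open set, because each mean entropy is a continuous
function of the measures of finitely many intersections (`tendsto_meanEntropy`). Once these sets are
known to be dense, Baire's theorem applies, the Halmos metric being complete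
(`completeSpace_halmosMetric`): the intersection over all natural `c` and `N` is a dense `G_δ`, and
on it `h_P ≥ c` for every `c`.

Density is the heart of the matter. Given `S` and `M`, put `ℓ = L(M)` and build a tower of `M`
floors over the product of `ℓ` copies of `X`. Its transformation `σ` climbs one floor and returns
from the top floor to the bottom one by the cyclic rotation of the coordinates. The map `(u, z) ↦
S^u z₀` sends the tower measure to `μ` and intertwines `σ` with `S` off the top floor, which has
measure `1/M`. On the other hand `σ^M` rotates independent coordinates, so for a partition read off
through this map the translates by `σ^M, σ^(2M), …, σ^(ℓM)` are independent, and their mean entropy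
is exactly `ln n`.

Tower and `X` are non-atomic standard spaces, hence isomorphic, and the isomorphism can be chosen to
match, modulo null sets, finitely many sets of `X` with their lifts (`exists_equiv_extension`).
Transporting `σ` to `X` gives `T` that is `1/M`-close to `S` on prescribed sets and has independent
translates of `ξ` along `P_M` (`exists_approx`). Letting `M → ∞` gives `T → S`. -/

theorem not_countable_of_nullSingleton (μ : Measure X) [NeZero μ] [NullSingletonClass μ] :
    ¬ Countable X := by
  intro h
  have : μ univ = 0 := (Set.countable_univ (α := X)).measure_zero μ
  exact NeZero.ne μ (Measure.measure_univ_eq_zero.1 this)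

/-- An uncountable standard Borel space contains an uncountable null set. -/
theorem exists_uncountable_null [StandardBorelSpace X] (μ : Measure X) [IsFiniteMeasure μ]
    (hX : ¬ Countable X) : ∃ K, MeasurableSet K ∧ ¬ K.Countable ∧ μ K = 0 := by
  have hR : ¬ Countable (ℝ × ℝ) := by
    intro h
    exact not_countable (α := ℝ) (Prod.mk_right_injective (0 : ℝ)).countable
  -- Identified with the plane, the space splits into uncountably many disjoint vertical lines, only
  -- countably many of which can have positive measure.
  let e := PolishSpace.measurableEquivOfNotCountable hX hR
  let s : ℝ → Set X := fun t => {x | (e x).1 = t}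
  have hs : ∀ t, MeasurableSet (s t) := fun t =>
    measurableSet_eq_fun (measurable_fst.comp e.measurable) measurable_const
  have hd : Pairwise (Function.onFun Disjoint s) := by
    intro a b hab
    refine Set.disjoint_left.2 fun x hx hx' => hab ?_
    exact hx.symm.trans hx'
  have hc := Measure.countable_meas_pos_of_disjoint_iUnion (μ := μ) hs hd
  obtain ⟨t, ht⟩ : ∃ t, t ∉ {i | 0 < μ (s i)} := by
    by_contra! h
    exact not_countable (α := ℝ) (Set.countable_univ_iff.1 (hc.mono fun x _ => h x))
  refine ⟨s t, hs t, fun hK => ?_, by simpa using ht⟩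
  have hinj : Function.Injective (fun r : ℝ => (⟨e.symm (t, r), by simp [s]⟩ : s t)) := by
    intro a b hab
    have := e.symm.injective (congrArg Subtype.val hab)
    exact (Prod.mk.inj this).2
  have := hK.to_subtype
  exact not_countable (α := ℝ) hinj.countable

/-- A measurable bijection between standard Borel spaces is a measurable equivalence. -/
def measurableEquivOfEquiv [StandardBorelSpace X] [StandardBorelSpace Y] (e : X ≃ Y)
    (he : Measurable e) : X ≃ᵐ Y where
  toEquiv := e
  measurable_toFun := he
  measurable_invFun := by
    intro s hs
    rw [← e.image_eq_preimage_symm]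
    exact (he.measurableEmbedding e.injective).measurableSet_image.2 hs

/-- A measure-preserving map which is injective on a conull set agrees almost everywhere with an
everywhere defined isomorphism. -/
theorem exists_measurableEquiv_of_injOn [StandardBorelSpace X] [StandardBorelSpace Y]
    {μ : Measure X} {ν : Measure Y} [IsProbabilityMeasure μ] [IsProbabilityMeasure ν]
    [NullSingletonClass μ] [NullSingletonClass ν] {f : X → Y} (hf : MeasurePreserving f μ ν)
    {Z : Set X} (hZ : MeasurableSet Z) (hZ0 : μ Zᶜ = 0) (hinj : InjOn f Z) :
    ∃ e : X ≃ᵐ Y, e =ᵐ[μ] f ∧ MeasurePreserving e μ ν := by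
  classical
  obtain ⟨K, hKm, hKc, hK0⟩ := exists_uncountable_null ν (not_countable_of_nullSingleton ν)
  obtain ⟨K', hKm', hKc', hK0'⟩ := exists_uncountable_null μ (not_countable_of_nullSingleton μ)
  -- Deleting the null sets `f ⁻¹' K` and `K'` leaves uncountable complements of both `W` and `f ''
  -- W`. Those are then Borel isomorphic, and `f` is redefined on the null set `Wᶜ` by such an
  -- isomorphism.
  set W : Set X := Z \ (f ⁻¹' K ∪ K') with hW
  have hWm : MeasurableSet W := hZ.diff ((hf.measurable hKm).union hKm')
  have hWinj : InjOn f W := hinj.mono sdiff_subset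
  have hWc : μ Wᶜ = 0 := by
    have : Wᶜ ⊆ Zᶜ ∪ (f ⁻¹' K ∪ K') := by
      intro x hx
      by_contra h
      simp only [mem_union, mem_compl_iff, not_or, not_not] at h
      exact hx ⟨h.1, by simpa using h.2⟩
    refine measure_mono_null this ?_
    rw [measure_union_null_iff, measure_union_null_iff]
    exact ⟨hZ0, by rw [hf.measure_preimage hKm.nullMeasurableSet, hK0], hK0'⟩
  have hV : MeasurableSet (f '' W) := hWm.image_of_measurable_injOn hf.measurable hWinj
  have hc1 : ¬ Countable (Wᶜ : Set X) := fun h =>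
    hKc' ((Set.countable_coe_iff.1 h).mono
      (show K' ⊆ Wᶜ from fun x hx hxW => hxW.2 (Or.inr hx)))
  have hc2 : ¬ Countable ((f '' W)ᶜ : Set Y) := fun h =>
    hKc ((Set.countable_coe_iff.1 h).mono fun y hy => by
      rintro ⟨x, hx, rfl⟩
      exact hx.2 (Or.inl hy))
  have := hWm.compl.standardBorel
  have := hV.compl.standardBorel
  let k := PolishSpace.measurableEquivOfNotCountable hc1 hc2
  let g : X → Y := fun x => if h : x ∈ W then f x else k ⟨x, h⟩
  have hg : Measurable g := Measurable.dite (s := W) (hf.measurable.comp measurable_subtype_coe)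
    (measurable_subtype_coe.comp k.measurable) hWm
  have hgW : ∀ x ∈ W, g x = f x := fun x hx => dif_pos hx
  have hgW' : ∀ x (hx : x ∉ W), g x = k ⟨x, hx⟩ := fun x hx => dif_neg hx
  have hb : Function.Bijective g := by
    constructor
    · intro x y hxy
      by_cases hx : x ∈ W <;> by_cases hy : y ∈ W
      · rw [hgW x hx, hgW y hy] at hxy
        exact hWinj hx hy hxy
      · rw [hgW x hx, hgW' y hy] at hxy
        exact absurd ⟨x, hx, hxy⟩ (k ⟨y, hy⟩).2
      · rw [hgW' x hx, hgW y hy] at hxy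
        exact absurd ⟨y, hy, hxy.symm⟩ (k ⟨x, hx⟩).2
      · rw [hgW' x hx, hgW' y hy] at hxy
        exact congrArg Subtype.val (k.injective (Subtype.ext hxy))
    · intro y
      by_cases hy : y ∈ f '' W
      · obtain ⟨x, hx, rfl⟩ := hy
        exact ⟨x, hgW x hx⟩
      · obtain ⟨x, hx⟩ := k.surjective ⟨y, hy⟩
        exact ⟨x, by rw [hgW' x x.2]; simp [hx]⟩
  have hae : g =ᵐ[μ] f := by
    have : ∀ᵐ x ∂μ, x ∈ W := by rw [ae_iff]; exact hWc
    filter_upwards [this] with x hx using hgW x hx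
  refine ⟨measurableEquivOfEquiv (Equiv.ofBijective g hb) hg, hae, ?_⟩
  refine ⟨hg, ?_⟩
  rw [← hf.map_eq]
  exact Measure.map_congr hae

/-- The distribution function of a non-atomic probability measure on the line transports it to
Lebesgue measure on the unit interval. -/
theorem measurePreserving_cdf (μ : Measure ℝ) [IsProbabilityMeasure μ] [NullSingletonClass μ] :
    MeasurePreserving (ProbabilityTheory.cdf μ) μ (volume.restrict (Icc (0 : ℝ) 1)) := by
  set F := ProbabilityTheory.cdf μ with hF
  have hmono : Monotone F := ProbabilityTheory.monotone_cdf μ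
  have hcont : Continuous F := by
    rw [continuous_iff_continuousAt]
    intro x
    rw [hmono.continuousAt_iff_leftLim_eq_rightLim, F.rightLim_eq]
    have h := F.measure_singleton x
    rw [hF, ProbabilityTheory.measure_cdf, measure_singleton, ← hF] at h
    have := ENNReal.ofReal_eq_zero.1 h.symm
    exact le_antisymm (hmono.leftLim_le le_rfl) (by linarith)
  have : IsProbabilityMeasure (μ.map F) := Measure.isProbabilityMeasure_map hcont.aemeasurable
  refine ⟨hcont.measurable, Measure.ext_of_Iic _ _ fun t => ?_⟩
  rw [Measure.map_apply hcont.measurable measurableSet_Iic,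
    Measure.restrict_apply measurableSet_Iic]
  rcases le_or_gt 1 t with ht | ht
  · have h1 : F ⁻¹' Iic t = univ :=
      eq_univ_of_forall fun x => (ProbabilityTheory.cdf_le_one μ x).trans ht
    have h2 : Iic t ∩ Icc (0 : ℝ) 1 = Icc 0 1 := inter_eq_right.2 fun x hx => hx.2.trans ht
    simp [h1, h2]
  rcases (F ⁻¹' Iic t).eq_empty_or_nonempty with he | hne
  · have ht0 : t ≤ 0 := by
      by_contra! h
      obtain ⟨x, hx⟩ := ((ProbabilityTheory.tendsto_cdf_atBot μ).eventually_lt_const h).exists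
      have : x ∈ F ⁻¹' Iic t := hx.le
      simp [he] at this
    have : Iic t ∩ Icc (0 : ℝ) 1 ⊆ {0} := fun x hx => le_antisymm (hx.1.trans ht0) hx.2.1
    rw [he, measure_empty, measure_mono_null this (by simp)]
  · have hbdd : BddAbove (F ⁻¹' Iic t) := by
      obtain ⟨b, hb⟩ := ((ProbabilityTheory.tendsto_cdf_atTop μ).eventually_const_lt ht).exists
      refine ⟨b, fun x hx => ?_⟩
      by_contra! h
      exact absurd ((hmono h.le).trans hx) (not_le.2 hb)
    set s := sSup (F ⁻¹' Iic t) with hs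
    have hst : F s ≤ t := (isClosed_Iic.preimage hcont).csSup_mem hne hbdd
    have hset : F ⁻¹' Iic t = Iic s :=
      Subset.antisymm (fun x hx => le_csSup hbdd hx) fun x hx => (hmono hx).trans hst
    have hFs : F s = t := by
      refine le_antisymm hst ?_
      by_contra! h
      have h1 : ∀ᶠ x in 𝓝[>] s, F x < t :=
        (hcont.continuousAt.eventually_lt_const h).filter_mono nhdsWithin_le_nhds
      obtain ⟨x, hx1, hx2⟩ := (h1.and self_mem_nhdsWithin).exists
      exact absurd (le_csSup hbdd (show x ∈ F ⁻¹' Iic t from hx1.le)) (not_le.2 hx2)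
    have h0 : 0 ≤ t := hFs ▸ ProbabilityTheory.cdf_nonneg μ s
    have h2 : Iic t ∩ Icc (0 : ℝ) 1 = Icc 0 t := by
      ext x
      simp only [mem_inter_iff, mem_Iic, mem_Icc]
      constructor
      · rintro ⟨a, b, c⟩; exact ⟨b, a⟩
      · rintro ⟨a, b⟩; exact ⟨b, a, b.trans ht.le⟩
    rw [hset, h2, ← ProbabilityTheory.ofReal_cdf, ← hF, hFs, Real.volume_Icc, sub_zero]

/-- The distribution function fails to be injective only on its flat pieces. Each of them contains a
rational, so they are covered, up to left endpoints, by countably many level sets, which are null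
because the image measure has no atoms. -/
theorem exists_measurableEquiv_real (μ : Measure ℝ) [IsProbabilityMeasure μ]
    [NullSingletonClass μ] :
    ∃ e : ℝ ≃ᵐ ℝ, MeasurePreserving e μ (volume.restrict (Icc (0 : ℝ) 1)) := by
  have hp := measurePreserving_cdf μ
  set F := ProbabilityTheory.cdf μ with hF
  have hmono : Monotone F := ProbabilityTheory.monotone_cdf μ
  let D : Set ℝ := ⋃ q : ℚ, (F ⁻¹' {F q} ∩ Ioi (q : ℝ))
  have hDm : MeasurableSet D := MeasurableSet.iUnion fun q =>
    (hp.measurable (measurableSet_singleton _)).inter measurableSet_Ioi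
  have hD0 : μ D = 0 := by
    refine measure_iUnion_null fun q => measure_mono_null inter_subset_left ?_
    rw [hp.measure_preimage (measurableSet_singleton _).nullMeasurableSet, measure_singleton]
  have hinj' : ∀ x ∈ Dᶜ, ∀ y ∈ Dᶜ, F x = F y → ¬ x < y := by
    intro x _ y hy h hlt
    obtain ⟨q, hq1, hq2⟩ := exists_rat_btwn hlt
    refine hy (mem_iUnion.2 ⟨q, ?_, hq2⟩)
    exact le_antisymm (h ▸ hmono hq1.le) (hmono hq2.le)
  have : IsProbabilityMeasure (volume.restrict (Icc (0 : ℝ) 1)) := ⟨by simp⟩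
  obtain ⟨e, -, he⟩ := exists_measurableEquiv_of_injOn hp hDm.compl (by rwa [compl_compl])
    (fun x hx y hy h => le_antisymm (not_lt.1 (hinj' y hy x hx h.symm))
      (not_lt.1 (hinj' x hx y hy h)))
  exact ⟨e, he⟩

theorem nullSingletonClass_map_equiv (μ : Measure X) [NullSingletonClass μ] (e : X ≃ᵐ Y) :
    NullSingletonClass (μ.map e) := by
  refine ⟨fun y => ?_⟩
  rw [e.map_apply, ← e.image_symm, image_singleton, measure_singleton]

theorem exists_measurePreserving_equiv_real [StandardBorelSpace X] (μ : Measure X)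
    [IsProbabilityMeasure μ] [NullSingletonClass μ] :
    ∃ e : X ≃ᵐ ℝ, MeasurePreserving e μ (volume.restrict (Icc (0 : ℝ) 1)) := by
  let e := PolishSpace.measurableEquivOfNotCountable (not_countable_of_nullSingleton μ)
    (not_countable (α := ℝ))
  have := nullSingletonClass_map_equiv μ e
  have := Measure.isProbabilityMeasure_map (μ := μ) e.measurable.aemeasurable
  obtain ⟨g, hg⟩ := exists_measurableEquiv_real (μ.map e)
  exact ⟨e.trans g, hg.comp (e.measurable.measurePreserving μ)⟩

/-- Two non-atomic standard probability spaces are isomorphic. -/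
theorem exists_measurePreserving_equiv [StandardBorelSpace X] [StandardBorelSpace Y]
    (μ : Measure X) (ν : Measure Y) [IsProbabilityMeasure μ] [IsProbabilityMeasure ν]
    [NullSingletonClass μ] [NullSingletonClass ν] : ∃ e : X ≃ᵐ Y, MeasurePreserving e μ ν := by
  obtain ⟨e, he⟩ := exists_measurePreserving_equiv_real μ
  obtain ⟨g, hg⟩ := exists_measurePreserving_equiv_real ν
  exact ⟨e.trans g.symm, (hg.symm g).comp he⟩

theorem exists_measurePreserving_equiv_subtype [StandardBorelSpace X] [StandardBorelSpace Y]
    (μ : Measure X) (ν : Measure Y) [IsFiniteMeasure μ] [IsFiniteMeasure ν]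
    [NullSingletonClass μ] [NullSingletonClass ν] {s : Set X} {t : Set Y} (hs : MeasurableSet s)
    (ht : MeasurableSet t) (hst : μ s = ν t) (h0 : μ s ≠ 0) :
    ∃ e : s ≃ᵐ t, MeasurePreserving e (μ.comap Subtype.val) (ν.comap Subtype.val) := by
  have hs' := MeasurableEmbedding.subtype_coe hs
  have ht' := MeasurableEmbedding.subtype_coe ht
  have := hs.standardBorel
  have := ht.standardBorel
  set c := μ s with hc
  have htop : c ≠ ⊤ := measure_ne_top μ s
  -- Both restrictions have total mass `c`; they are normalized to apply the probability case, and
  -- the factor `c` is restored at the end.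
  have h1 : IsProbabilityMeasure (c⁻¹ • μ.comap (Subtype.val : s → X)) := ⟨by
    rw [Measure.smul_apply, hs'.comap_apply, image_univ, Subtype.range_coe, smul_eq_mul, ← hc,
      ENNReal.inv_mul_cancel h0 htop]⟩
  have h2 : IsProbabilityMeasure (c⁻¹ • ν.comap (Subtype.val : t → Y)) := ⟨by
    rw [Measure.smul_apply, ht'.comap_apply, image_univ, Subtype.range_coe, smul_eq_mul, ← hst,
      ENNReal.inv_mul_cancel h0 htop]⟩
  have h3 : NullSingletonClass (c⁻¹ • μ.comap (Subtype.val : s → X)) := ⟨fun x => by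
    rw [Measure.smul_apply, hs'.comap_apply, image_singleton, measure_singleton, smul_zero]⟩
  have h4 : NullSingletonClass (c⁻¹ • ν.comap (Subtype.val : t → Y)) := ⟨fun x => by
    rw [Measure.smul_apply, ht'.comap_apply, image_singleton, measure_singleton, smul_zero]⟩
  obtain ⟨e, he⟩ := exists_measurePreserving_equiv (c⁻¹ • μ.comap (Subtype.val : s → X))
    (c⁻¹ • ν.comap (Subtype.val : t → Y))
  refine ⟨e, ?_⟩
  have := he.smul_measure c
  rwa [smul_smul, smul_smul, ENNReal.mul_inv_cancel h0 htop, one_smul, one_smul] at this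

/-- Isomorphisms between the fibres of two labellings, all fibres being empty or of positive
measure, are glued together. -/
theorem exists_measurePreserving_equiv_of_fiber_ne_zero [StandardBorelSpace X]
    [StandardBorelSpace Y] (μ : Measure X) (ν : Measure Y) [IsFiniteMeasure μ]
    [IsFiniteMeasure ν] [NullSingletonClass μ] [NullSingletonClass ν] {ι : Type*} [Countable ι]
    {f : X → ι} {g : Y → ι} (hf : ∀ i, MeasurableSet (f ⁻¹' {i}))
    (hg : ∀ i, MeasurableSet (g ⁻¹' {i})) (hfg : ∀ i, μ (f ⁻¹' {i}) = ν (g ⁻¹' {i}))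
    (hf0 : ∀ x, μ (f ⁻¹' {f x}) ≠ 0) (hg0 : ∀ y, ν (g ⁻¹' {g y}) ≠ 0) :
    ∃ e : X ≃ᵐ Y, MeasurePreserving e μ ν ∧ ∀ x, g (e x) = f x := by
  have hex : ∀ i, ∃ e : f ⁻¹' {i} ≃ᵐ g ⁻¹' {i},
      MeasurePreserving e (μ.comap Subtype.val) (ν.comap Subtype.val) := by
    intro i
    by_cases h0 : μ (f ⁻¹' {i}) = 0
    · have hX : IsEmpty (f ⁻¹' {i}) := ⟨fun ⟨x, hx⟩ => hf0 x (by rw [show f x = i from hx, h0])⟩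
      have hY : IsEmpty (g ⁻¹' {i}) :=
        ⟨fun ⟨y, hy⟩ => hg0 y (by rw [show g y = i from hy, ← hfg, h0])⟩
      refine ⟨⟨Equiv.equivOfIsEmpty _ _, measurable_of_empty _, measurable_of_empty _⟩,
        measurable_of_empty _, ?_⟩
      exact Measure.ext fun s _ => by rw [s.eq_empty_of_isEmpty]; simp
    · exact exists_measurePreserving_equiv_subtype μ ν (hf i) (hg i) (hfg i) h0
  choose e he using hex
  let F : X → Y := fun x => e (f x) ⟨x, rfl⟩
  have hF : ∀ x, g (F x) = f x := fun x => (e (f x) ⟨x, rfl⟩).2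
  have hFi : ∀ i x (hx : f x = i), F x = e i ⟨x, hx⟩ := by rintro i x rfl; rfl
  have hpre : ∀ B : Set Y, F ⁻¹' B =
      ⋃ i, (Subtype.val '' ((e i) ⁻¹' (Subtype.val ⁻¹' B : Set (g ⁻¹' {i})))) := by
    intro B
    ext x
    simp only [mem_preimage, mem_iUnion, mem_image, Subtype.exists, exists_and_right,
      exists_eq_right]
    constructor
    · exact fun h => ⟨f x, rfl, h⟩
    · rintro ⟨i, hi, h⟩
      rwa [hFi i x hi]
  have hmeas : ∀ B : Set Y, MeasurableSet B → ∀ i, MeasurableSet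
      (Subtype.val '' ((e i) ⁻¹' (Subtype.val ⁻¹' B : Set (g ⁻¹' {i})))) := fun B hB i =>
    (hf i).subtype_image ((e i).measurable (measurable_subtype_coe hB))
  have hFm : Measurable F := fun B hB => by
    rw [hpre]; exact MeasurableSet.iUnion (hmeas B hB)
  have hb : Function.Bijective F := by
    constructor
    · intro x y hxy
      have h : f y = f x := by rw [← hF, ← hF, hxy]
      rw [hFi _ y h] at hxy
      exact congrArg Subtype.val ((e (f x)).injective (Subtype.ext hxy))
    · intro y
      obtain ⟨⟨x, hx⟩, hxy⟩ := (e (g y)).surjective ⟨y, rfl⟩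
      exact ⟨x, by rw [hFi _ x hx, hxy]⟩
  refine ⟨measurableEquivOfEquiv (Equiv.ofBijective F hb) hFm, ⟨hFm, ?_⟩, hF⟩
  ext B hB
  change μ.map F B = ν B
  have hBU : B = ⋃ i, (Subtype.val '' (Subtype.val ⁻¹' B : Set (g ⁻¹' {i}))) := by
    ext y
    simp
  rw [Measure.map_apply hFm hB, hpre, measure_iUnion _ (hmeas B hB)]
  · conv_rhs => rw [hBU]
    rw [measure_iUnion _ fun i => (hg i).subtype_image (measurable_subtype_coe hB)]
    · refine tsum_congr fun i => ?_
      rw [← (MeasurableEmbedding.subtype_coe (hf i)).comap_apply,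
        ← (MeasurableEmbedding.subtype_coe (hg i)).comap_apply,
        (he i).measure_preimage (measurable_subtype_coe hB).nullMeasurableSet]
    · intro i j hij
      refine Set.disjoint_left.2 ?_
      rintro _ ⟨⟨x, hx⟩, -, rfl⟩ ⟨⟨y, hy⟩, -, hxy⟩
      exact hij (hx.symm.trans ((congrArg g hxy).symm.trans hy))
  · intro i j hij
    refine Set.disjoint_left.2 ?_
    rintro _ ⟨⟨x, hx⟩, -, rfl⟩ ⟨⟨y, hy⟩, -, hxy⟩
    exact hij (hx.symm.trans ((congrArg f hxy).symm.trans hy))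

/-- Two non-atomic standard probability spaces with labellings of the same distribution are
isomorphic by an isomorphism that respects the labels almost everywhere. -/
theorem exists_measurePreserving_equiv_of_label [StandardBorelSpace X] [StandardBorelSpace Y]
    (μ : Measure X) (ν : Measure Y) [IsProbabilityMeasure μ] [IsProbabilityMeasure ν]
    [NullSingletonClass μ] [NullSingletonClass ν] {ι : Type*} [Countable ι]
    [MeasurableSpace ι] [MeasurableSingletonClass ι] {f : X → ι} {g : Y → ι} (hf : Measurable f)
    (hg : Measurable g) (hfg : μ.map f = ν.map g) :
    ∃ e : X ≃ᵐ Y, MeasurePreserving e μ ν ∧ ∀ᵐ x ∂μ, g (e x) = f x := by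
  classical
  set τ := μ.map f with hτ
  have : IsProbabilityMeasure τ := Measure.isProbabilityMeasure_map hf.aemeasurable
  have hN : τ {i | τ {i} = 0} = 0 :=
    (measure_null_iff_singleton (Set.to_countable _)).2 fun i hi => hi
  obtain ⟨i₀, hi₀⟩ : ∃ i, τ {i} ≠ 0 := by
    by_contra! h
    have h1 : {i | τ {i} = 0} = univ := eq_univ_of_forall h
    rw [h1] at hN
    simp at hN
  -- Labels of measure zero are merged into a label `i₀` of positive measure, so that every nonempty
  -- fibre has positive measure. This changes the labels on null sets only.
  let r : ι → ι := fun i => if τ {i} = 0 then i₀ else i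
  have hr : Measurable r := measurable_of_countable r
  have hae : ∀ᵐ i ∂τ, r i = i := by
    rw [ae_iff]
    refine measure_mono_null (fun i hi => ?_) hN
    by_contra h
    exact hi (if_neg h)
  have hpos : ∀ i, τ (r ⁻¹' {r i}) ≠ 0 := by
    intro i
    have h1 : τ {r i} ≠ 0 := by
      by_cases h : τ {i} = 0
      · simpa [r, h] using hi₀
      · simp [r, h]
    have h2 : r (r i) = r i := if_neg h1
    exact fun h => h1 (measure_mono_null (by simpa using h2) h)
  have hfr : ∀ i, μ ((r ∘ f) ⁻¹' {i}) = τ (r ⁻¹' {i}) := fun i => by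
    rw [preimage_comp, hτ, Measure.map_apply hf (hr (measurableSet_singleton i))]
  have hgr : ∀ i, ν ((r ∘ g) ⁻¹' {i}) = τ (r ⁻¹' {i}) := fun i => by
    rw [preimage_comp, hfg, Measure.map_apply hg (hr (measurableSet_singleton i))]
  obtain ⟨e, he, hlab⟩ := exists_measurePreserving_equiv_of_fiber_ne_zero μ ν
    (f := r ∘ f) (g := r ∘ g) (fun i => (hr.comp hf) (measurableSet_singleton i))
    (fun i => (hr.comp hg) (measurableSet_singleton i)) (fun i => by rw [hfr, hgr])
    (fun x => by rw [hfr]; exact hpos _) (fun y => by rw [hgr]; exact hpos _)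
  refine ⟨e, he, ?_⟩
  have h1 : ∀ᵐ x ∂μ, r (f x) = f x := ae_of_ae_map hf.aemeasurable hae
  have h2 : ∀ᵐ y ∂ν, r (g y) = g y := by
    rw [hfg] at hae
    exact ae_of_ae_map hg.aemeasurable hae
  filter_upwards [h1, he.quasiMeasurePreserving.ae h2] with x hx1 hx2
  rw [← hx2, ← hx1]
  exact hlab x

end Isomorphism


/-! ### Convergence in the Halmos metric -/

section Convergence

variable {X : Type*} [MeasurableSpace X] {μ : Measure X}

theorem imageDist_mk (B : Set X) (S T : mpGroup μ) :
    imageDist μ B (S : Aut μ) (T : Aut μ) =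
      μ.real (((S : Equiv.Perm X) '' B) ∆ ((T : Equiv.Perm X) '' B)) := rfl

theorem measurableSet_image_mpGroup (S : mpGroup μ) {B : Set X} (hB : MeasurableSet B) :
    MeasurableSet ((S : Equiv.Perm X) '' B) := by
  rw [Equiv.image_eq_preimage_symm]
  exact S.2.2.measurable hB

/-- Translating the two sets does not change their distance. -/
theorem measureReal_image_symmDiff (S : mpGroup μ) {B C : Set X} (hB : MeasurableSet B)
    (hC : MeasurableSet C) :
    μ.real (((S : Equiv.Perm X) '' B) ∆ ((S : Equiv.Perm X) '' C)) = μ.real (B ∆ C) := by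
  rw [← Set.image_symmDiff (S : Equiv.Perm X).injective, measureReal_image μ S (hB.symmDiff hC)]

theorem halmosDist_inv (A : ℕ → Set X) (S T : Aut μ) :
    halmosDist μ A S⁻¹ T⁻¹ = halmosDist μ A S T := by
  simp only [halmosDist, inv_inv]
  exact tsum_congr fun i => by rw [add_comm]

/-- The partition `⋁_{p ∈ F} S^p ξ`. -/
abbrev orbitJoin (F : Finset ℤ) {n : ℕ} (ξ : MeasPartition X (Fin n)) (S : mpGroup μ) :
    MeasPartition X (F → Fin n) :=
  MeasPartition.join fun p : F => ξ.image (S ^ (p : ℤ))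

theorem meanEntropy_mk (F : Finset ℤ) {n : ℕ} (ξ : MeasPartition X (Fin n)) (S : mpGroup μ) :
    meanEntropy μ F ξ (S : Aut μ) = (1 / (F.card : ℝ)) *
      -∑ a, μ.real ((orbitJoin F ξ S).cell a) * Real.log (μ.real ((orbitJoin F ξ S).cell a)) :=
  rfl

theorem measureReal_preimage_symmDiff {E : Type*} [MeasurableSpace E] {ν : Measure E}
    {f : X → E} (hf : MeasurePreserving f μ ν) {B C : Set E} (hB : MeasurableSet B)
    (hC : MeasurableSet C) : μ.real ((f ⁻¹' B) ∆ (f ⁻¹' C)) = ν.real (B ∆ C) := by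
  rw [← preimage_symmDiff, Measure.real, Measure.real,
    hf.measure_preimage (hB.symmDiff hC).nullMeasurableSet]

variable [IsProbabilityMeasure μ]

theorem imageDist_le_add (S T : Aut μ) {B C : Set X} (hB : MeasurableSet B)
    (hC : MeasurableSet C) : imageDist μ B S T ≤ imageDist μ C S T + 2 * μ.real (C ∆ B) := by
  induction S, T using Quotient.inductionOn₂ with | _ S T
  change μ.real (((S : Equiv.Perm X) '' B) ∆ ((T : Equiv.Perm X) '' B)) ≤
    μ.real (((S : Equiv.Perm X) '' C) ∆ ((T : Equiv.Perm X) '' C)) + _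
  have h1 := measureReal_image_symmDiff S hB hC
  have h2 := measureReal_image_symmDiff T hC hB
  rw [symmDiff_comm] at h1
  have t1 := measureReal_symmDiff_le (μ := μ) (s := (S : Equiv.Perm X) '' B)
    (t := (S : Equiv.Perm X) '' C) ((T : Equiv.Perm X) '' B)
  have t2 := measureReal_symmDiff_le (μ := μ) (s := (S : Equiv.Perm X) '' C)
    (t := (T : Equiv.Perm X) '' C) ((T : Equiv.Perm X) '' B)
  rw [symmDiff_comm ((S : Equiv.Perm X) '' B) ((S : Equiv.Perm X) '' C)] at t1
  rw [symmDiff_comm B C] at h1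
  linarith

theorem imageDist_le_halmosDist (A : ℕ → Set X) (i : ℕ) (S T : Aut μ) :
    imageDist μ (A i) S T ≤ 2 ^ i * halmosDist μ A S T := by
  have hle := (summable_halmos μ A S T).le_tsum i (fun j _ => mul_nonneg (by positivity)
    (add_nonneg (imageDist_nonneg μ (A j) S T) (imageDist_nonneg μ (A j) S⁻¹ T⁻¹)))
  have h2 : (2 : ℝ) ^ i * (1 / 2) ^ i = 1 := by rw [← mul_pow]; norm_num
  have := mul_le_mul_of_nonneg_left hle (show (0 : ℝ) ≤ 2 ^ i by positivity)
  rw [← mul_assoc, h2, one_mul] at this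
  exact (le_add_of_nonneg_right (imageDist_nonneg _ _ _ _)).trans this

/-- Convergence in the Halmos metric implies convergence on every measurable set. -/
theorem tendsto_imageDist {A : ℕ → Set X} (hA : IsDenseSeq μ A) {α : Type*} {l : Filter α}
    {u v : α → Aut μ} (h : Tendsto (fun a => halmosDist μ A (u a) (v a)) l (𝓝 0)) {B : Set X}
    (hB : MeasurableSet B) : Tendsto (fun a => imageDist μ B (u a) (v a)) l (𝓝 0) := by
  rw [Metric.tendsto_nhds]
  intro ε hε
  obtain ⟨i, hi⟩ := hA.exists_lt B hB (ε / 4) (by positivity)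
  have h1 : Tendsto (fun a => 2 ^ i * halmosDist μ A (u a) (v a)) l (𝓝 0) := by
    simpa using h.const_mul (2 ^ i)
  filter_upwards [h1.eventually_lt_const (half_pos hε)] with a ha
  rw [Real.dist_eq, sub_zero, abs_of_nonneg (imageDist_nonneg _ _ _ _)]
  have h2 := imageDist_le_add (u a) (v a) hB (hA.measurableSet i)
  have h3 := imageDist_le_halmosDist A i (u a) (v a)
  linarith

/-- Convergence on the sets of the dense sequence, for the transformations and their inverses,
implies convergence in the Halmos metric. -/
theorem tendsto_halmosDist {A : ℕ → Set X} {α : Type*} {l : Filter α} {u v : α → Aut μ}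
    (h : ∀ i, Tendsto (fun a => imageDist μ (A i) (u a) (v a)) l (𝓝 0))
    (h' : ∀ i, Tendsto (fun a => imageDist μ (A i) (u a)⁻¹ (v a)⁻¹) l (𝓝 0)) :
    Tendsto (fun a => halmosDist μ A (u a) (v a)) l (𝓝 0) := by
  have key := tendsto_tsum_of_dominated_convergence (𝓕 := l)
    (f := fun a i => (1 / 2 : ℝ) ^ i *
      (imageDist μ (A i) (u a) (v a) + imageDist μ (A i) (u a)⁻¹ (v a)⁻¹))
    (g := fun _ => 0) (summable_geometric_two.mul_right (μ.real univ + μ.real univ))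
    (fun i => by simpa using ((h i).add (h' i)).const_mul ((1 / 2 : ℝ) ^ i))
    (Eventually.of_forall fun a i => by
      rw [Real.norm_of_nonneg (mul_nonneg (by positivity)
        (add_nonneg (imageDist_nonneg _ _ _ _) (imageDist_nonneg _ _ _ _)))]
      exact mul_le_mul_of_nonneg_left
        (add_le_add (imageDist_le _ _ _ _) (imageDist_le _ _ _ _)) (by positivity))
  simpa [halmosDist] using key

/-- Compare `T^(n+1) B` with `S^(n+1) B` through `T (S^n B)`: the first distance equals that of `T^n
B` and `S^n B` since `T` preserves `μ`, and the second compares `T` and `S` on the fixed set `S^n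
B`. -/
theorem tendsto_imageDist_pow {A : ℕ → Set X} (hA : IsDenseSeq μ A) {α : Type*} {l : Filter α}
    {u : α → Aut μ} {S : Aut μ} (h : Tendsto (fun a => halmosDist μ A (u a) S) l (𝓝 0))
    {B : Set X} (hB : MeasurableSet B) (n : ℕ) :
    Tendsto (fun a => imageDist μ B (u a ^ n) (S ^ n)) l (𝓝 0) := by
  induction n with
  | zero => simpa [imageDist_self] using tendsto_const_nhds
  | succ n ih =>
    induction S using Quotient.inductionOn with | _ S
    have hC := measurableSet_image_mpGroup (S ^ n) hB
    refine squeeze_zero (fun a => imageDist_nonneg _ _ _ _) (fun a => ?_)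
      (by simpa using ih.add (tendsto_imageDist hA h hC))
    generalize u a = T
    induction T using Quotient.inductionOn with | _ T
    change μ.real ((((T ^ (n + 1) : mpGroup μ) : Equiv.Perm X) '' B) ∆
        (((S ^ (n + 1) : mpGroup μ) : Equiv.Perm X) '' B)) ≤
      μ.real ((((T ^ n : mpGroup μ) : Equiv.Perm X) '' B) ∆
        (((S ^ n : mpGroup μ) : Equiv.Perm X) '' B)) +
      μ.real (((T : Equiv.Perm X) '' (((S ^ n : mpGroup μ) : Equiv.Perm X) '' B)) ∆
        ((S : Equiv.Perm X) '' (((S ^ n : mpGroup μ) : Equiv.Perm X) '' B)))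
    have hsucc : ∀ R : mpGroup μ, ((R ^ (n + 1) : mpGroup μ) : Equiv.Perm X) '' B =
        (R : Equiv.Perm X) '' (((R ^ n : mpGroup μ) : Equiv.Perm X) '' B) := fun R => by
      rw [pow_succ', Subgroup.coe_mul, Equiv.Perm.coe_mul, image_comp]
    rw [hsucc, hsucc, ← measureReal_image_symmDiff T (measurableSet_image_mpGroup (T ^ n) hB) hC]
    exact measureReal_symmDiff_le _

theorem tendsto_imageDist_zpow {A : ℕ → Set X} (hA : IsDenseSeq μ A) {α : Type*} {l : Filter α}
    {u : α → Aut μ} {S : Aut μ} (h : Tendsto (fun a => halmosDist μ A (u a) S) l (𝓝 0))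
    {B : Set X} (hB : MeasurableSet B) (p : ℤ) :
    Tendsto (fun a => imageDist μ B (u a ^ p) (S ^ p)) l (𝓝 0) := by
  obtain ⟨n, rfl | rfl⟩ := p.eq_nat_or_neg
  · simpa using tendsto_imageDist_pow hA h hB n
  · have h' : Tendsto (fun a => halmosDist μ A (u a)⁻¹ S⁻¹) l (𝓝 0) := by
      simpa only [halmosDist_inv] using h
    simpa using tendsto_imageDist_pow hA h' hB n

theorem abs_measureReal_orbitJoin_sub_le (F : Finset ℤ) {n : ℕ} (ξ : MeasPartition X (Fin n))
    (S T : mpGroup μ) (a : F → Fin n) :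
    |μ.real ((orbitJoin F ξ S).cell a) - μ.real ((orbitJoin F ξ T).cell a)| ≤
      ∑ p : F, imageDist μ (ξ.cell (a p)) ((S : Aut μ) ^ (p : ℤ)) ((T : Aut μ) ^ (p : ℤ)) := by
  refine (abs_measureReal_sub_le_measureReal_symmDiff
    ((orbitJoin F ξ S).measurableSet_cell a).nullMeasurableSet
    ((orbitJoin F ξ T).measurableSet_cell a).nullMeasurableSet).trans ?_
  refine le_trans (measureReal_mono ?_) (measureReal_iUnion_fintype_le fun p : F =>
    (((S ^ (p : ℤ) : mpGroup μ) : Equiv.Perm X) '' ξ.cell (a p)) ∆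
      (((T ^ (p : ℤ) : mpGroup μ) : Equiv.Perm X) '' ξ.cell (a p)))
  intro x hx
  simp only [MeasPartition.join, MeasPartition.image, mem_symmDiff, mem_iInter, mem_iUnion]
    at hx ⊢
  grind

/-- Only finitely many cells and powers occur, each cell measure converges, and `x ln x` is
continuous also at `0`. -/
theorem tendsto_meanEntropy {A : ℕ → Set X} (hA : IsDenseSeq μ A) {α : Type*} {l : Filter α}
    {u : α → Aut μ} {S : Aut μ} (h : Tendsto (fun a => halmosDist μ A (u a) S) l (𝓝 0))
    (F : Finset ℤ) {n : ℕ} (ξ : MeasPartition X (Fin n)) :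
    Tendsto (fun a => meanEntropy μ F ξ (u a)) l (𝓝 (meanEntropy μ F ξ S)) := by
  obtain ⟨S, rfl⟩ := QuotientGroup.mk_surjective S
  choose t ht using fun a => QuotientGroup.mk_surjective (s := nullGroup μ) (u a)
  have hcell : ∀ b : F → Fin n, Tendsto (fun a => μ.real ((orbitJoin F ξ (t a)).cell b)) l
      (𝓝 (μ.real ((orbitJoin F ξ S).cell b))) := by
    intro b
    rw [tendsto_iff_dist_tendsto_zero]
    refine squeeze_zero (fun a => dist_nonneg)
      (fun a => abs_measureReal_orbitJoin_sub_le F ξ (t a) S b) ?_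
    have := tendsto_finsetSum (Finset.univ : Finset F) (fun p _ =>
      tendsto_imageDist_zpow hA h (ξ.measurableSet_cell (b p)) (p : ℤ))
    simpa [ht] using this
  simp_rw [← ht, meanEntropy_mk]
  refine Tendsto.const_mul _ (Tendsto.neg (tendsto_finsetSum _ fun b _ => ?_))
  exact (Real.continuous_mul_log.tendsto _).comp (hcell b)

end Convergence

/-! ### Completeness of the Halmos metric -/

section Completeness

variable {X : Type*} [MeasurableSpace X] {μ : Measure X} [IsProbabilityMeasure μ]

/-- The almost everywhere limit of maps with the same distribution has that distribution. -/
theorem measurePreserving_of_ae_tendsto {E : Type*} [TopologicalSpace E]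
    [TopologicalSpace.PseudoMetrizableSpace E] [MeasurableSpace E] [BorelSpace E] {ν : Measure E} [IsProbabilityMeasure ν] {f : ℕ → X → E}
    {g : X → E} (hf : ∀ k, MeasurePreserving (f k) μ ν) (hg : Measurable g)
    (h : ∀ᵐ x ∂μ, Tendsto (fun k => f k x) atTop (𝓝 (g x))) : MeasurePreserving g μ ν := by
  refine ⟨hg, ?_⟩
  have := Measure.isProbabilityMeasure_map (μ := μ) hg.aemeasurable
  refine ext_of_forall_integral_eq_of_IsFiniteMeasure fun φ => ?_
  have hφ := φ.continuous
  rw [integral_map hg.aemeasurable hφ.aestronglyMeasurable]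
  have h1 : Tendsto (fun k => ∫ x, φ (f k x) ∂μ) atTop (𝓝 (∫ x, φ (g x) ∂μ)) := by
    refine tendsto_integral_of_dominated_convergence (fun _ => ‖φ‖)
      (fun k => (hφ.measurable.comp (hf k).measurable).aestronglyMeasurable)
      (integrable_const _) (fun k => ae_of_all _ fun x => φ.norm_coe_le_norm _) ?_
    filter_upwards [h] with x hx using (hφ.tendsto _).comp hx
  have h2 : ∀ k, ∫ x, φ (f k x) ∂μ = ∫ y, φ y ∂ν := fun k => by
    rw [← (hf k).map_eq, integral_map (hf k).measurable.aemeasurable hφ.aestronglyMeasurable]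
  simp_rw [h2] at h1
  exact tendsto_nhds_unique h1 tendsto_const_nhds |>.symm ▸ rfl

/-- If `g x ∈ U`, then `f k x ∈ U` eventually, so the intersection of the preimages fills up `g ⁻¹'
U`. The preimages have equal measure, so the symmetric difference is twice the missing part. -/
theorem tendsto_measureReal_preimage_symmDiff_of_isOpen {E : Type*} [TopologicalSpace E]
    [MeasurableSpace E] [BorelSpace E] {ν : Measure E} {f : ℕ → X → E}
    {g : X → E} (hf : ∀ k, MeasurePreserving (f k) μ ν) (hg : MeasurePreserving g μ ν)
    (h : ∀ᵐ x ∂μ, Tendsto (fun k => f k x) atTop (𝓝 (g x))) {U : Set E} (hU : IsOpen U) :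
    Tendsto (fun k => μ.real ((f k ⁻¹' U) ∆ (g ⁻¹' U))) atTop (𝓝 0) := by
  have hgU := hg.measurable hU.measurableSet
  have hfU := fun k => (hf k).measurable hU.measurableSet
  have h1 : Tendsto (fun k => μ (f k ⁻¹' U ∩ g ⁻¹' U)) atTop (𝓝 (μ (g ⁻¹' U))) := by
    refine tendsto_measure_of_ae_tendsto_indicator_of_isFiniteMeasure atTop hgU
      (fun k => (hfU k).inter hgU) ?_
    filter_upwards [h] with x hx
    by_cases hxU : g x ∈ U
    · filter_upwards [hx.eventually_mem (hU.mem_nhds hxU)] with k hk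
      simp [hk]
    · exact Eventually.of_forall fun k => by simp [hxU]
  have h2 : Tendsto (fun k => μ.real (f k ⁻¹' U ∩ g ⁻¹' U)) atTop (𝓝 (μ.real (g ⁻¹' U))) :=
    (ENNReal.tendsto_toReal (measure_ne_top _ _)).comp h1
  have h3 : ∀ k, μ.real ((f k ⁻¹' U) ∆ (g ⁻¹' U)) =
      2 * (μ.real (g ⁻¹' U) - μ.real (f k ⁻¹' U ∩ g ⁻¹' U)) := by
    intro k
    have e1 : μ.real (f k ⁻¹' U) = μ.real (g ⁻¹' U) := by
      rw [Measure.real, Measure.real, (hf k).measure_preimage hU.measurableSet.nullMeasurableSet,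
        hg.measure_preimage hU.measurableSet.nullMeasurableSet]
    have e2 := measureReal_inter_add_sdiff (μ := μ) (s := f k ⁻¹' U) hgU
    have e3 := measureReal_inter_add_sdiff (μ := μ) (s := g ⁻¹' U) (hfU k)
    rw [inter_comm] at e3
    rw [measureReal_symmDiff_eq (hfU k) hgU]
    linarith
  simp_rw [h3]
  simpa using (h2.const_sub (μ.real (g ⁻¹' U))).const_mul 2

theorem tendsto_measureReal_preimage_symmDiff {E : Type*} [TopologicalSpace E]
    [TopologicalSpace.PseudoMetrizableSpace E] [MeasurableSpace E] [BorelSpace E] {ν : Measure E} [IsProbabilityMeasure ν] {f : ℕ → X → E}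
    {g : X → E} (hf : ∀ k, MeasurePreserving (f k) μ ν) (hg : MeasurePreserving g μ ν)
    (h : ∀ᵐ x ∂μ, Tendsto (fun k => f k x) atTop (𝓝 (g x))) {B : Set E} (hB : MeasurableSet B) :
    Tendsto (fun k => μ.real ((f k ⁻¹' B) ∆ (g ⁻¹' B))) atTop (𝓝 0) := by
  rw [Metric.tendsto_nhds]
  intro ε hε
  -- Outer regularity replaces `B` by an open set; measure-preserving maps carry the error over
  -- unchanged.
  obtain ⟨U, hBU, hU, hUε⟩ := B.exists_isOpen_lt_add (μ := ν) (measure_ne_top ν B)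
    (ε := ENNReal.ofReal (ε / 4)) (by simpa using hε)
  have hlt : ν.real (B ∆ U) < ε / 4 := by
    have h1 : ν.real U < ν.real B + ε / 4 := by
      have := (ENNReal.toReal_lt_toReal (measure_ne_top ν U) (by finiteness)).2 hUε
      rwa [ENNReal.toReal_add (measure_ne_top ν B) (by finiteness),
        ENNReal.toReal_ofReal (by positivity)] at this
    have h2 : ν.real (U \ B) = ν.real U - ν.real B := measureReal_sdiff hBU hB
    rw [measureReal_symmDiff_eq hB hU.measurableSet, sdiff_eq_empty.2 hBU]
    simp only [measureReal_empty, zero_add]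
    linarith
  have h0 := tendsto_measureReal_preimage_symmDiff_of_isOpen hf hg h hU
  filter_upwards [h0.eventually_lt_const (half_pos hε)] with k hk
  rw [Real.dist_eq, sub_zero, abs_of_nonneg measureReal_nonneg]
  have e1 := measureReal_preimage_symmDiff (hf k) hB hU.measurableSet
  have e2 := measureReal_preimage_symmDiff hg hU.measurableSet hB
  rw [symmDiff_comm U B] at e2
  have t1 := measureReal_symmDiff_le (μ := μ) (s := f k ⁻¹' B) (t := f k ⁻¹' U) (g ⁻¹' B)
  have t2 := measureReal_symmDiff_le (μ := μ) (s := f k ⁻¹' U) (t := g ⁻¹' U) (g ⁻¹' B)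
  linarith

/-- A sequence of points of the Cantor space whose coordinates are eventually constant
converges. -/
theorem exists_tendsto_of_eventually_eq {f : ℕ → ℕ → Bool}
    (h : ∀ i, ∀ᶠ k in atTop, f k i = f (k + 1) i) : ∃ l, Tendsto f atTop (𝓝 l) := by
  have : ∀ i, ∃ b, ∀ᶠ k in atTop, f k i = b := by
    intro i
    obtain ⟨K, hK⟩ := eventually_atTop.1 (h i)
    refine ⟨f K i, eventually_atTop.2 ⟨K, fun k hk => ?_⟩⟩
    induction k, hk using Nat.le_induction with
    | base => rfl
    | succ k hk ih => rw [← hK k hk, ih]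
  choose b hb using this
  refine ⟨b, tendsto_pi_nhds.2 fun i => ?_⟩
  exact tendsto_const_nhds.congr' ((hb i).mono fun k hk => hk.symm)

/-- Measure-preserving maps that converge fast on the sets of a coding of the space by the
Cantor space converge, on every measurable set, to a measure-preserving map. -/
theorem exists_limit_of_summable (e : X ≃ᵐ (ℕ → Bool)) {t : ℕ → X → X}
    (ht : ∀ k, MeasurePreserving (t k) μ μ)
    (hsum : ∀ i, ∑' k, μ ((t k ⁻¹' {x | e x i = true}) ∆ (t (k + 1) ⁻¹' {x | e x i = true})) ≠ ⊤) :
    ∃ g : X → X, MeasurePreserving g μ μ ∧ ∀ B, MeasurableSet B →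
      Tendsto (fun k => μ.real ((t k ⁻¹' B) ∆ (g ⁻¹' B))) atTop (𝓝 0) := by
  set ν := μ.map e with hν
  have : IsProbabilityMeasure ν := Measure.isProbabilityMeasure_map e.measurable.aemeasurable
  have hme : MeasurePreserving e μ ν := e.measurable.measurePreserving μ
  have hf : ∀ k, MeasurePreserving (e ∘ t k) μ ν := fun k => hme.comp (ht k)
  have hae : ∀ᵐ x ∂μ, ∃ l, Tendsto (fun k => (e ∘ t k) x) atTop (𝓝 l) := by
    -- Borel–Cantelli: almost every point lies in only finitely many of the symmetric differences,
    -- so each coordinate of its code is eventually constant.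
    have h1 := fun i => ae_eventually_notMem (hsum i)
    filter_upwards [ae_all_iff.2 h1] with x hx
    refine exists_tendsto_of_eventually_eq fun i => ?_
    filter_upwards [hx i] with k hk
    simp only [mem_symmDiff, mem_preimage, mem_ofPred_eq, Function.comp_apply] at hk ⊢
    grind
  obtain ⟨g, hg, hgt⟩ := measurable_limit_of_tendsto_metrizable_ae
    (fun k => (hf k).measurable.aemeasurable) hae
  have hgp := measurePreserving_of_ae_tendsto hf hg hgt
  refine ⟨e.symm ∘ g, (hme.symm e).comp hgp, fun B hB => ?_⟩
  have := tendsto_measureReal_preimage_symmDiff hf hgp hgt (e.symm.measurable hB)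
  refine this.congr fun k => ?_
  congr 2
  ext x
  simp

variable [StandardBorelSpace X]

/-- Limits of transformations and of their inverses are inverse to each other. -/
theorem ae_comp_eq_of_limits {t : ℕ → mpGroup μ} {g h : X → X}
    (hh : MeasurePreserving h μ μ)
    (htg : ∀ B, MeasurableSet B → Tendsto
      (fun k => μ.real (((t k : Equiv.Perm X) ⁻¹' B) ∆ (g ⁻¹' B))) atTop (𝓝 0))
    (hth : ∀ B, MeasurableSet B → Tendsto
      (fun k => μ.real (((t k : Equiv.Perm X).symm ⁻¹' B) ∆ (h ⁻¹' B))) atTop (𝓝 0)) :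
    ∀ᵐ x ∂μ, h (g x) = x := by
  have key : (h ∘ g) =ᵐ[μ] id := by
    refine Filter.EventuallyEq.of_forall_separating_preimage (p := MeasurableSet) fun B hB => ?_
    rw [← measure_symmDiff_eq_zero_iff, ← measureReal_eq_zero_iff, preimage_id, preimage_comp]
    have hC := hh.measurable hB
    refine le_antisymm ?_ measureReal_nonneg
    refine ge_of_tendsto (by simpa using (htg _ hC).add (hth _ hB))
      (Eventually.of_forall fun k => ?_)
    -- Pulling back by `t k` turns the distance between `h ⁻¹' B` and the preimage of `B` under the
    -- inverse of `t k` into the distance between `t k ⁻¹' (h ⁻¹' B)` and `B`.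
    have h1 := measureReal_preimage_symmDiff (t k).2.1 hC ((t k).2.2.measurable hB)
    have h2 : (t k : Equiv.Perm X) ⁻¹' ((t k : Equiv.Perm X).symm ⁻¹' B) = B := by
      ext x; simp
    rw [h2] at h1
    have h3 := measureReal_symmDiff_le (μ := μ) (s := g ⁻¹' (h ⁻¹' B))
      (t := (t k : Equiv.Perm X) ⁻¹' (h ⁻¹' B)) B
    rw [symmDiff_comm (h ⁻¹' B)] at h1
    rw [symmDiff_comm (g ⁻¹' (h ⁻¹' B)) ((t k : Equiv.Perm X) ⁻¹' _)] at h3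
    rw [← h1]
    exact h3
  exact key

/-- In a standard Borel space a measure-preserving bijection has a measure-preserving inverse. -/
def mpGroup.ofPerm (e : Equiv.Perm X) (he : MeasurePreserving e μ μ) : mpGroup μ :=
  ⟨e, he, MeasurePreserving.symm (measurableEquivOfEquiv e he.measurable) he⟩

/-- Along a fast subsequence of a Cauchy sequence the maps and their inverses both converge
pointwise almost everywhere, in Cantor coordinates. The symmetry of the metric under inversion is
what makes the limit invertible. -/
theorem completeSpace_halmosMetric [NullSingletonClass μ] (A : ℕ → Set X)
    (hA : IsDenseSeq μ A) :
    letI : MetricSpace (Aut μ) := halmosMetric μ A hA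
    CompleteSpace (Aut μ) := by
  let _ : MetricSpace (Aut μ) := halmosMetric μ A hA
  refine Metric.complete_of_cauchySeq_tendsto fun u hu => ?_
  choose s hs using fun n => QuotientGroup.mk_surjective (s := nullGroup μ) (u n)
  let e := PolishSpace.measurableEquivNatBoolOfNotCountable (not_countable_of_nullSingleton μ)
  let B : ℕ → Set X := fun i => {x | e x i = true}
  have hB : ∀ i, MeasurableSet (B i) := fun i =>
    ((measurable_pi_apply i).comp e.measurable) (measurableSet_singleton true)
  have hu0 : Tendsto (fun q : ℕ × ℕ => halmosDist μ A (u q.1) (u q.2)) atTop (𝓝 0) :=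
    cauchySeq_iff_tendsto_dist_atTop_0.1 hu
  have hu1 : Tendsto (fun q : ℕ × ℕ => halmosDist μ A (u q.1)⁻¹ (u q.2)⁻¹) atTop (𝓝 0) := by
    simpa only [halmosDist_inv] using hu0
  -- At stage `k` only the coding sets of index at most `k` are controlled; for each fixed set the
  -- bounds `2⁻ᵏ` then hold from some `k` on, which suffices for summability.
  have hfast : ∀ k : ℕ, ∃ N, ∀ n ≥ N, ∀ m ≥ n, ∀ i ≤ k,
      imageDist μ (B i) (u n) (u m) < (1 / 2) ^ k ∧
      imageDist μ (B i) (u n)⁻¹ (u m)⁻¹ < (1 / 2) ^ k := by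
    intro k
    have h1 : ∀ i, ∀ᶠ q : ℕ × ℕ in atTop, imageDist μ (B i) (u q.1) (u q.2) < (1 / 2) ^ k ∧
        imageDist μ (B i) (u q.1)⁻¹ (u q.2)⁻¹ < (1 / 2) ^ k := fun i =>
      ((tendsto_imageDist hA hu0 (hB i)).eventually_lt_const (by positivity)).and
        ((tendsto_imageDist hA hu1 (hB i)).eventually_lt_const (by positivity))
    have h2 := (Filter.eventually_all_finite (Set.finite_Iic k)).2 fun i _ => h1 i
    obtain ⟨⟨N, M⟩, hN⟩ := eventually_atTop.1 h2
    exact ⟨max N M, fun n hn m hm i hi => hN (n, m)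
      ⟨(le_max_left _ _).trans hn, ((le_max_right _ _).trans hn).trans hm⟩ i hi⟩
  obtain ⟨φ, hφ, hφk⟩ := extraction_forall_of_eventually' hfast
  have hsumm : ∀ (i : ℕ) (d : ℕ → Set X), (∀ k, i ≤ k → μ.real (d k) < (1 / 2) ^ k) →
      ∑' k, μ (d k) ≠ ⊤ := by
    intro i d hd
    have hS : Summable fun k => μ.real (d k) := by
      refine (summable_nat_add_iff i).1 (Summable.of_nonneg_of_le (fun _ => measureReal_nonneg)
        (fun k => (hd (k + i) (Nat.le_add_left _ _)).le) ?_)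
      exact (summable_nat_add_iff i).2 summable_geometric_two
    have : ∑' k, μ (d k) = ENNReal.ofReal (∑' k, μ.real (d k)) := by
      rw [ENNReal.ofReal_tsum_of_nonneg (fun k => measureReal_nonneg) hS]
      exact tsum_congr fun k => by rw [ofReal_measureReal]
    rw [this]
    exact ENNReal.ofReal_ne_top
  have hcons : ∀ k i, i ≤ k →
      imageDist μ (B i) (u (φ k)) (u (φ (k + 1))) < (1 / 2) ^ k ∧
      imageDist μ (B i) (u (φ k))⁻¹ (u (φ (k + 1)))⁻¹ < (1 / 2) ^ k := fun k i hi =>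
    hφk k _ (hφ.monotone (Nat.le_succ k)) i hi
  have hinvd : ∀ (C : Set X) (S T : mpGroup μ), imageDist μ C (S : Aut μ)⁻¹ (T : Aut μ)⁻¹ =
      μ.real (((S : Equiv.Perm X) ⁻¹' C) ∆ ((T : Equiv.Perm X) ⁻¹' C)) := by
    intro C S T
    rw [← QuotientGroup.mk_inv, ← QuotientGroup.mk_inv, imageDist_mk, Subgroup.coe_inv,
      Subgroup.coe_inv]
    simp only [Equiv.Perm.inv_def, Equiv.image_symm_eq_preimage]
  obtain ⟨g, hg, hgt⟩ := exists_limit_of_summable e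
    (t := fun k => (s (φ k) : Equiv.Perm X)) (fun k => (s (φ k)).2.1)
    (fun i => hsumm i _ fun k hk => by
      have := (hcons k i hk).2
      rwa [← hs, ← hs, hinvd] at this)
  obtain ⟨h, hh, hht⟩ := exists_limit_of_summable e
    (t := fun k => (s (φ k) : Equiv.Perm X).symm) (fun k => (s (φ k)).2.2)
    (fun i => hsumm i _ fun k hk => by
      have := (hcons k i hk).1
      rw [← hs, ← hs, imageDist_mk] at this
      simpa only [Equiv.image_eq_preimage_symm] using this)
  have hgh := ae_comp_eq_of_limits (t := fun k => s (φ k)) hh hgt hht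
  -- The limit `g` has the left inverse `h` on a conull set, hence is injective there and can be
  -- corrected to a bijection of the whole space.
  obtain ⟨f, hfg, hf⟩ := exists_measurableEquiv_of_injOn hg
    (measurableSet_eq_fun (hh.measurable.comp hg.measurable) measurable_id)
    (ae_iff.1 hgh)
    (fun x hx y hy hxy => by
      have hx' : h (g x) = x := hx
      have hy' : h (g y) = y := hy
      rw [← hx', ← hy', hxy])
  let S : mpGroup μ := mpGroup.ofPerm f.toEquiv hf
  have hSg : ∀ C : Set X, ((S : Equiv.Perm X) ⁻¹' C : Set X) =ᵐ[μ] (g ⁻¹' C : Set X) := by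
    intro C
    rw [eventuallyEq_set]
    filter_upwards [hfg] with x hx
    change f x ∈ C ↔ g x ∈ C
    rw [hx]
  have hlim : ∀ C, MeasurableSet C →
      Tendsto (fun k => μ.real (((s (φ k) : Equiv.Perm X) ⁻¹' C) ∆ ((S : Equiv.Perm X) ⁻¹' C)))
        atTop (𝓝 0) := by
    intro C hC
    refine (hgt C hC).congr fun k => ?_
    exact measureReal_congr (ae_eq_set_symmDiff (ae_eq_refl _) (hSg C).symm)
  refine ⟨(S : Aut μ), tendsto_nhds_of_cauchySeq_of_subseq hu hφ.tendsto_atTop ?_⟩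
  rw [tendsto_iff_dist_tendsto_zero]
  change Tendsto (fun k => halmosDist μ A (u (φ k)) (S : Aut μ)) atTop (𝓝 0)
  refine tendsto_halmosDist (fun i => ?_) (fun i => ?_)
  -- The pullback of `T A ∆ S A` by `T` is `A ∆ T⁻¹(S A)`, the symmetric difference of the preimages
  -- of `S A` under `S` and `T`.
  · refine (hlim _ (measurableSet_image_mpGroup S (hA.measurableSet i))).congr fun k => ?_
    rw [← hs, imageDist_mk, ← measureReal_preimage_symmDiff (s (φ k)).2.1
      (measurableSet_image_mpGroup (s (φ k)) (hA.measurableSet i))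
      (measurableSet_image_mpGroup S (hA.measurableSet i)), symmDiff_comm,
      preimage_image_eq _ (Equiv.injective _), preimage_image_eq _ (Equiv.injective _)]
  · refine (hlim _ (hA.measurableSet i)).congr fun k => ?_
    rw [← hs, hinvd]

end Completeness


/-! ### A tower over a rotation of independent copies -/

section Tower

/-- The uniform probability measure on `Fin M`. -/
abbrev unifFin (M : ℕ) : Measure (Fin M) := ProbabilityTheory.uniformOn univ

theorem unifFin_singleton {M : ℕ} [NeZero M] (i : Fin M) : (unifFin M).real {i} = 1 / M := by
  simp [Measure.real, ProbabilityTheory.uniformOn_univ]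

theorem measurePreserving_unifFin {M : ℕ} [NeZero M] (e : Equiv.Perm (Fin M)) :
    MeasurePreserving e (unifFin M) (unifFin M) := by
  refine ⟨measurable_of_countable _, Measure.ext_of_singleton fun i => ?_⟩
  rw [Measure.map_apply (measurable_of_countable _) (measurableSet_singleton _),
    ← e.image_symm_eq_preimage]
  simp [ProbabilityTheory.uniformOn_univ]

variable {X : Type*}

/-- The rotation of the coordinates of `ZMod ℓ → X`. -/
def rotation (X : Type*) (ℓ : ℕ) : Equiv.Perm (ZMod ℓ → X) :=
  Equiv.arrowCongr (Equiv.subRight 1) (Equiv.refl X)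

theorem rotation_apply {ℓ : ℕ} (z : ZMod ℓ → X) (i : ZMod ℓ) : rotation X ℓ z i = z (i + 1) := rfl

theorem rotation_pow_apply {ℓ : ℕ} (k : ℕ) (z : ZMod ℓ → X) (i : ZMod ℓ) :
    (rotation X ℓ ^ k) z i = z (i + k) := by
  induction k generalizing z with
  | zero => simp
  | succ k ih =>
    rw [pow_succ, Equiv.Perm.mul_apply, ih, rotation_apply]
    push_cast
    rw [add_assoc]

/-- Going up one floor; from the top floor one returns to the bottom by the rotation. -/
def towerPerm (X : Type*) (M ℓ : ℕ) [NeZero M] : Equiv.Perm (Fin M × (ZMod ℓ → X)) :=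
  Equiv.prodShear (Equiv.addRight 1) fun u => if u + 1 = 0 then rotation X ℓ else Equiv.refl _

theorem towerPerm_apply {M ℓ : ℕ} [NeZero M] (y : Fin M × (ZMod ℓ → X)) :
    towerPerm X M ℓ y = (y.1 + 1, if y.1 + 1 = 0 then rotation X ℓ y.2 else y.2) := by
  change (y.1 + 1, (if y.1 + 1 = 0 then rotation X ℓ else Equiv.refl _) y.2) = _
  split_ifs <;> rfl

/-- The quotient by `M` counts the returns to the bottom floor, each of which contributes one
rotation. -/
theorem towerPerm_pow_apply {M ℓ : ℕ} [NeZero M] (n : ℕ) (y : Fin M × (ZMod ℓ → X)) :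
    ((towerPerm X M ℓ ^ n) y).1.val = (y.1.val + n) % M ∧
      ((towerPerm X M ℓ ^ n) y).2 = (rotation X ℓ ^ ((y.1.val + n) / M)) y.2 := by
  induction n with
  | zero => simp [Nat.mod_eq_of_lt y.1.2, Nat.div_eq_of_lt y.1.2]
  | succ n ih =>
    obtain ⟨ih1, ih2⟩ := ih
    rw [pow_succ', Equiv.Perm.mul_apply, towerPerm_apply]
    set q := (towerPerm X M ℓ ^ n) y
    have h1 : (q.1 + 1).val = (y.1.val + (n + 1)) % M := by
      rw [Fin.val_add, Fin.val_one', ih1, ← Nat.add_mod, add_assoc]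
    refine ⟨h1, ?_⟩
    have h2 : q.1 + 1 = 0 ↔ M ∣ y.1.val + n + 1 := by
      rw [Fin.ext_iff, h1, Fin.val_zero, Nat.dvd_iff_mod_eq_zero, add_assoc]
    simp only [h2]
    rw [← add_assoc, Nat.succ_div]
    split_ifs
    · rw [pow_succ', Equiv.Perm.mul_apply, ih2]
    · rw [ih2, add_zero]

theorem towerPerm_pow_mul_apply {M ℓ : ℕ} [NeZero M] (k : ℕ) (y : Fin M × (ZMod ℓ → X)) :
    (towerPerm X M ℓ ^ (k * M)) y = (y.1, (rotation X ℓ ^ k) y.2) := by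
  obtain ⟨h1, h2⟩ := towerPerm_pow_apply (k * M) y
  rw [Nat.add_mul_mod_self_right, Nat.mod_eq_of_lt y.1.2] at h1
  rw [Nat.add_mul_div_right _ _ (NeZero.pos M), Nat.div_eq_of_lt y.1.2, zero_add] at h2
  exact Prod.ext (Fin.ext h1) h2

variable [MeasurableSpace X]

theorem measurePreserving_rotation (μ : Measure X) [IsProbabilityMeasure μ] (ℓ : ℕ) [NeZero ℓ] :
    MeasurePreserving (rotation X ℓ) (Measure.pi fun _ : ZMod ℓ => μ)
      (Measure.pi fun _ : ZMod ℓ => μ) :=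
  measurePreserving_arrowCongr' (fun _ => μ) (fun _ => μ) (Equiv.subRight (1 : ZMod ℓ))
    (MeasurableEquiv.refl X) fun _ => MeasurePreserving.id μ

/-- The measure on the tower with `M` floors over `ℓ` independent copies of `(X, μ)`. -/
abbrev towerMeasure (μ : Measure X) (M ℓ : ℕ) [NeZero ℓ] : Measure (Fin M × (ZMod ℓ → X)) :=
  (unifFin M).prod (Measure.pi fun _ : ZMod ℓ => μ)

theorem measurePreserving_towerPerm (μ : Measure X) [IsProbabilityMeasure μ] (M ℓ : ℕ) [NeZero M]
    [NeZero ℓ] :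
    MeasurePreserving (towerPerm X M ℓ) (towerMeasure μ M ℓ) (towerMeasure μ M ℓ) := by
  refine MeasurePreserving.skew_product (μc := Measure.pi fun _ : ZMod ℓ => μ)
    (μd := Measure.pi fun _ : ZMod ℓ => μ) (measurePreserving_unifFin (Equiv.addRight (1 : Fin M)))
    (g := fun u => ⇑(if u + 1 = 0 then rotation X ℓ else Equiv.refl (ZMod ℓ → X))) ?_
    (ae_of_all _ fun u => ?_)
  · refine measurable_from_prod_countable_right fun u => ?_
    simp only [Function.uncurry_apply_pair]
    split_ifs
    · exact (measurePreserving_rotation μ ℓ).measurable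
    · exact measurable_id
  · split_ifs
    · exact (measurePreserving_rotation μ ℓ).map_eq
    · exact Measure.map_id

variable {μ : Measure X}

/-- On the `u`-th floor every coordinate is moved by `S ^ u`. -/
def towerMap (S : mpGroup μ) {M ℓ : ℕ} (y : Fin M × (ZMod ℓ → X)) : ZMod ℓ → X :=
  fun i => ((S ^ y.1.val : mpGroup μ) : Equiv.Perm X) (y.2 i)

theorem measurePreserving_towerMap [IsProbabilityMeasure μ] (S : mpGroup μ) (M ℓ : ℕ) [NeZero M]
    [NeZero ℓ] :
    MeasurePreserving (towerMap S) (towerMeasure μ M ℓ) (Measure.pi fun _ : ZMod ℓ => μ) := by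
  have hu : ∀ u : Fin M, MeasurePreserving
      (fun (z : ZMod ℓ → X) i => ((S ^ u.val : mpGroup μ) : Equiv.Perm X) (z i))
      (Measure.pi fun _ : ZMod ℓ => μ) (Measure.pi fun _ : ZMod ℓ => μ) := fun u =>
    measurePreserving_pi _ _ fun _ => (S ^ u.val).2.1
  have h := MeasurePreserving.skew_product (MeasurePreserving.id (unifFin M))
    (g := fun u (z : ZMod ℓ → X) i => ((S ^ u.val : mpGroup μ) : Equiv.Perm X) (z i))
    (measurable_from_prod_countable_right fun u => (hu u).measurable)
    (ae_of_all _ fun u => (hu u).map_eq)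
  exact measurePreserving_snd.comp h

/-- Times that are multiples of the height keep the floor, and so the power of `S`; they only shift
the index. Multiples `k` distinct modulo `ℓ` thus read distinct, independent coordinates. -/
theorem towerMap_towerPerm_pow_inv (S : mpGroup μ) {M ℓ : ℕ} [NeZero M] (k : ℕ)
    (y : Fin M × (ZMod ℓ → X)) (i : ZMod ℓ) :
    towerMap S ((towerPerm X M ℓ ^ (k * M))⁻¹ y) i = towerMap S y (i - k) := by
  obtain ⟨q, rfl⟩ := (towerPerm X M ℓ ^ (k * M)).surjective y
  rw [Equiv.Perm.inv_def, Equiv.symm_apply_apply, towerPerm_pow_mul_apply]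
  simp only [towerMap, rotation_pow_apply, sub_add_cancel]

theorem towerMap_towerPerm (S : mpGroup μ) {M ℓ : ℕ} [NeZero M] (y : Fin M × (ZMod ℓ → X))
    (hy : y.1 + 1 ≠ 0) (i : ZMod ℓ) :
    towerMap S (towerPerm X M ℓ y) i = (S : Equiv.Perm X) (towerMap S y i) := by
  have hval : (y.1 + 1).val = y.1.val + 1 := by
    have h0 : (y.1.val + 1) % M ≠ 0 := fun h => hy (Fin.ext (by
      rw [Fin.val_add, Fin.val_one', Nat.add_mod_mod, h, Fin.val_zero]))
    have hlt : y.1.val + 1 < M := by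
      refine lt_of_le_of_ne y.1.2 fun h => h0 ?_
      rw [h, Nat.mod_self]
    rw [Fin.val_add, Fin.val_one', Nat.add_mod_mod, Nat.mod_eq_of_lt hlt]
  rw [towerPerm_apply, if_neg hy]
  simp only [towerMap, hval, pow_succ', Subgroup.coe_mul, Equiv.Perm.mul_apply]

end Tower

/-! ### Approximation by automorphisms with independent samples -/

section Approximation

variable {X : Type*} [MeasurableSpace X] {μ : Measure X}

/-- Independence of the translates of an equidistributed partition gives the largest possible
mean entropy. -/
theorem meanEntropy_eq_log {F : Finset ℤ} (hF : F.Nonempty) {n : ℕ} [NeZero n]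
    {ξ : MeasPartition X (Fin n)} (hξ : ∀ i, μ.real (ξ.cell i) = 1 / n) {T : mpGroup μ}
    (hT : ∀ a, μ.real ((orbitJoin F ξ T).cell a) = ∏ p : F, μ.real (ξ.cell (a p))) :
    meanEntropy μ F ξ (T : Aut μ) = Real.log n := by
  have hF0 : (F.card : ℝ) ≠ 0 := by exact_mod_cast hF.card_ne_zero
  have hn : (n : ℝ) ≠ 0 := by exact_mod_cast NeZero.ne n
  rw [meanEntropy_mk]
  simp only [hT, hξ, Finset.prod_const, Finset.card_univ, Finset.sum_const, Fintype.card_coe,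
    Fintype.card_fun, Fintype.card_fin, nsmul_eq_mul, Real.log_pow, Real.log_div one_ne_zero hn,
    Real.log_one]
  have hpow : (n : ℝ) ^ F.card * (1 / (n : ℝ)) ^ F.card = 1 := by
    rw [← mul_pow, mul_one_div_cancel hn, one_pow]
  push_cast
  rw [← mul_assoc, hpow]
  field_simp
  ring

variable [StandardBorelSpace X] [IsProbabilityMeasure μ] [NullSingletonClass μ]

/-- A non-atomic extension of `X` is isomorphic to `X` by an isomorphism that keeps finitely many
sets in place. -/
theorem exists_equiv_extension {Y : Type*} [MeasurableSpace Y] [StandardBorelSpace Y]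
    {ν : Measure Y} [IsProbabilityMeasure ν] [NullSingletonClass ν] {π : Y → X}
    (hπ : MeasurePreserving π ν μ) {κ : Type*} [Finite κ] {D : κ → Set X}
    (hD : ∀ i, MeasurableSet (D i)) :
    ∃ φ : X ≃ᵐ Y, MeasurePreserving φ μ ν ∧ ∀ᵐ x ∂μ, ∀ i, π (φ x) ∈ D i ↔ x ∈ D i := by
  classical
  -- A point is labelled by the sets `D i` that contain it. As `π` preserves measure, `f` and `f ∘
  -- π` have the same distribution.
  let f : X → κ → Bool := fun x i => decide (x ∈ D i)
  have hf : Measurable f := measurable_pi_lambda _ fun i => measurable_to_bool (by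
    convert hD i using 1
    ext x
    simp [f])
  obtain ⟨φ, hφ, hlab⟩ := exists_measurePreserving_equiv_of_label μ ν hf
    (hf.comp hπ.measurable) (by rw [← Measure.map_map hf hπ.measurable, hπ.map_eq])
  refine ⟨φ, hφ, ?_⟩
  filter_upwards [hlab] with x hx i
  simpa [f] using congrFun hx i

/-- `T` is the tower transformation transported to `X`. Closeness to `S` comes from the height `M`,
independence from the `ℓ` coordinates of the base. -/
theorem exists_approx (S : mpGroup μ) (M ℓ : ℕ) [NeZero M] [NeZero ℓ] {κ : Type*} [Finite κ]
    {D : κ → Set X} (hD : ∀ i, MeasurableSet (D i)) {n : ℕ} (ξ : MeasPartition X (Fin n)) :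
    ∃ T : mpGroup μ,
      (∀ i, imageDist μ (D i) (T : Aut μ) (S : Aut μ) ≤ 1 / M ∧
        imageDist μ (D i) (T : Aut μ)⁻¹ (S : Aut μ)⁻¹ ≤ 1 / M) ∧
      ∀ (F : Finset ℤ) (β : F ≃ ZMod ℓ),
        (∀ p : F, ∃ k : ℕ, (p : ℤ) = (k * M : ℕ) ∧ β p = -(k : ZMod ℓ)) →
        ∀ a, μ.real ((orbitJoin F ξ T).cell a) = ∏ p : F, μ.real (ξ.cell (a p)) := by
  have hw := measurePreserving_towerMap S M ℓ
  have hπ : MeasurePreserving (fun y => towerMap S y 0) (towerMeasure μ M ℓ) μ :=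
    (measurePreserving_eval (fun _ : ZMod ℓ => μ) 0).comp hw
  -- The sets to be matched with their lifts: `D i` and its image and preimage under `S` for the two
  -- distance estimates, and the cells of `ξ` for independence.
  let D' : (κ ⊕ κ ⊕ κ) ⊕ Fin n → Set X :=
    Sum.elim (Sum.elim D (Sum.elim (fun i => (S : Equiv.Perm X) '' D i)
      (fun i => (S : Equiv.Perm X) ⁻¹' D i))) ξ.cell
  have hD' : ∀ i, MeasurableSet (D' i) := by
    rintro ((i | i | i) | i)
    · exact hD i
    · exact measurableSet_image_mpGroup S (hD i)
    · exact S.2.1.measurable (hD i)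
    · exact ξ.measurableSet_cell i
  obtain ⟨φ, hφ, hφD⟩ := exists_equiv_extension hπ hD'
  set σ := towerPerm X M ℓ with hσ
  have hσp := measurePreserving_towerPerm μ M ℓ
  let T₀ : Equiv.Perm X := φ.toEquiv.symm.permCongrHom σ
  have hT₀ : MeasurePreserving T₀ μ μ := (hφ.symm φ).comp (hσp.comp hφ)
  let T : mpGroup μ := mpGroup.ofPerm T₀ hT₀
  have hTφ : ∀ (p : ℤ) x, φ (((T ^ p : mpGroup μ) : Equiv.Perm X) x) = (σ ^ p) (φ x) := by
    intro p x
    have : ((T ^ p : mpGroup μ) : Equiv.Perm X) = φ.toEquiv.symm.permCongrHom (σ ^ p) := by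
      rw [map_zpow]; rfl
    rw [this]
    exact φ.apply_symm_apply _
  have hT1 : ∀ x, φ ((T : Equiv.Perm X) x) = σ (φ x) := fun x => by simpa using hTφ 1 x
  -- The part of `X` over the top floor, the only place where the factor map may fail to intertwine
  -- `T` with `S`.
  let E : Set X := {x | (φ x).1 + 1 = 0}
  have hEμ : μ.real E = 1 / M := by
    have h1 : E = φ ⁻¹' (Prod.fst ⁻¹' {(-1 : Fin M)}) := by
      ext x
      simp [E, eq_neg_iff_add_eq_zero]
    have h2 : MeasurePreserving (Prod.fst ∘ φ) μ (unifFin M) := measurePreserving_fst.comp hφ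
    rw [h1, ← preimage_comp, Measure.real,
      h2.measure_preimage (measurableSet_singleton _).nullMeasurableSet]
    exact unifFin_singleton _
  have hstep : ∀ x ∉ E, towerMap S (φ ((T : Equiv.Perm X) x)) 0 =
      (S : Equiv.Perm X) (towerMap S (φ x) 0) := fun x hx => by
    rw [hT1, towerMap_towerPerm S _ hx]
  have hTae := T.2.1.quasiMeasurePreserving.ae hφD
  have hle : ∀ (i : κ), μ.real (((T : Equiv.Perm X) ⁻¹' D i) ∆ ((S : Equiv.Perm X) ⁻¹' D i)) ≤
      1 / M := by
    intro i
    rw [← hEμ]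
    refine ENNReal.toReal_mono (measure_ne_top _ _) (measure_mono_ae ?_)
    filter_upwards [hφD, hTae] with x hx hTx hmem
    by_contra hxE
    have e1 := hTx (Sum.inl (Sum.inl i))
    have e2 := hx (Sum.inl (Sum.inr (Sum.inr i)))
    simp only [D', Sum.elim_inl, Sum.elim_inr, mem_preimage] at e1 e2
    rw [hstep x hxE] at e1
    have hmem' : x ∈ ((T : Equiv.Perm X) ⁻¹' D i) ∆ ((S : Equiv.Perm X) ⁻¹' D i) := hmem
    simp only [mem_symmDiff, mem_preimage] at hmem'
    tauto
  have hle' : ∀ (i : κ), μ.real (((T : Equiv.Perm X) '' D i) ∆ ((S : Equiv.Perm X) '' D i)) ≤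
      1 / M := by
    intro i
    rw [← measureReal_preimage_symmDiff T.2.1 (measurableSet_image_mpGroup T (hD i))
      (measurableSet_image_mpGroup S (hD i)), preimage_image_eq _ (Equiv.injective _), ← hEμ]
    refine ENNReal.toReal_mono (measure_ne_top _ _) (measure_mono_ae ?_)
    filter_upwards [hφD, hTae] with x hx hTx hmem
    by_contra hxE
    have e1 := hTx (Sum.inl (Sum.inr (Sum.inl i)))
    have e2 := hx (Sum.inl (Sum.inl i))
    simp only [D', Sum.elim_inl, Sum.elim_inr] at e1 e2
    rw [hstep x hxE, (Equiv.injective _).mem_set_image] at e1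
    have hmem' : x ∈ D i ∆ ((T : Equiv.Perm X) ⁻¹' ((S : Equiv.Perm X) '' D i)) := hmem
    simp only [mem_symmDiff, mem_preimage] at hmem'
    tauto
  refine ⟨T, fun i => ⟨hle' i, ?_⟩, ?_⟩
  · rw [← QuotientGroup.mk_inv, ← QuotientGroup.mk_inv, imageDist_mk, Subgroup.coe_inv,
      Subgroup.coe_inv]
    simpa only [Equiv.Perm.inv_def, Equiv.image_symm_eq_preimage] using hle i
  intro F β hβ a
  -- Each cell of the join is, modulo null sets, the preimage of a box, because `T^(-kM)` moves
  -- coordinate `-k` to position `0`. The product measure of the box then factorizes.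
  have hcell : ((orbitJoin F ξ T).cell a : Set X) =ᵐ[μ]
      ((towerMap S ∘ φ) ⁻¹' (univ.pi fun i => ξ.cell (a (β.symm i))) : Set X) := by
    have hall : ∀ᵐ x ∂μ, ∀ p : F, ∀ i,
        towerMap S (φ ((((T ^ (p : ℤ))⁻¹ : mpGroup μ) : Equiv.Perm X) x)) 0 ∈ D' i ↔
          (((T ^ (p : ℤ))⁻¹ : mpGroup μ) : Equiv.Perm X) x ∈ D' i :=
      ae_all_iff.2 fun p => ((T ^ (p : ℤ))⁻¹).2.1.quasiMeasurePreserving.ae hφD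
    rw [eventuallyEq_set]
    filter_upwards [hall] with x hx
    simp only [MeasPartition.join, MeasPartition.image, mem_iInter, mem_preimage, mem_univ_pi,
      Function.comp_apply, Equiv.image_eq_preimage_symm]
    rw [← β.forall_congr_right]
    refine forall_congr' fun p => ?_
    obtain ⟨k, hk, hkβ⟩ := hβ p
    have e1 := hx p (Sum.inr (a p))
    simp only [D', Sum.elim_inr] at e1
    have e2 : φ ((((T ^ (p : ℤ))⁻¹ : mpGroup μ) : Equiv.Perm X) x) = (σ ^ (k * M))⁻¹ (φ x) := by
      rw [← zpow_neg, hTφ, zpow_neg, hk, zpow_natCast]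
    rw [e2, towerMap_towerPerm_pow_inv, zero_sub, ← hkβ] at e1
    rw [Equiv.symm_apply_apply, e1]
    rfl
  rw [measureReal_congr hcell, Measure.real, (hw.comp hφ).measure_preimage
    (MeasurableSet.univ_pi fun i => ξ.measurableSet_cell _).nullMeasurableSet, Measure.pi_pi,
    ENNReal.toReal_prod, ← β.prod_comp]
  simp [Measure.real]

theorem card_progression (L : ℕ → ℕ) (M : ℕ) [NeZero M] : (progression L M).card = L M := by
  rw [progression, Finset.card_image_of_injective, Nat.card_Icc, Nat.add_sub_cancel]
  intro a b hab
  have hM : (M : ℤ) ≠ 0 := by exact_mod_cast NeZero.ne M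
  exact_mod_cast mul_right_cancel₀ hM hab

/-- The terms `k M` of a progression are numbered by the residues of `-k`. -/
theorem exists_progression_equiv (L : ℕ → ℕ) (M : ℕ) [NeZero M] [NeZero (L M)] :
    ∃ β : progression L M ≃ ZMod (L M),
      ∀ p : progression L M, ∃ k : ℕ, (p : ℤ) = (k * M : ℕ) ∧ β p = -(k : ZMod (L M)) := by
  have hmem : ∀ p : progression L M, ∃ k : ℕ, k ∈ Finset.Icc 1 (L M) ∧ (p : ℤ) = (k * M : ℕ) := by
    rintro ⟨p, hp⟩
    obtain ⟨k, hk, rfl⟩ := Finset.mem_image.1 hp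
    exact ⟨k, hk, by push_cast; rfl⟩
  choose k hk hpk using hmem
  have hb : Function.Bijective fun p : progression L M => -(k p : ZMod (L M)) := by
    rw [Fintype.bijective_iff_injective_and_card]
    refine ⟨fun p q hpq => ?_, by simp [card_progression, ZMod.card]⟩
    have h1 := (ZMod.natCast_eq_natCast_iff _ _ _).1 (neg_injective hpq)
    have hp := Finset.mem_Icc.1 (hk p)
    have hq := Finset.mem_Icc.1 (hk q)
    -- The multipliers run from `1` to `L M`; shifted by one they become remainders below `L M`, so
    -- congruence forces equality.
    have h2 : k p - 1 ≡ k q - 1 [MOD L M] := by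
      refine Nat.ModEq.add_right_cancel' 1 ?_
      rwa [Nat.sub_add_cancel hp.1, Nat.sub_add_cancel hq.1]
    have h3 := h2.eq_of_lt_of_lt (by omega) (by omega)
    have h4 : k p = k q := by omega
    exact Subtype.ext (by rw [hpk, hpk, h4])
  exact ⟨Equiv.ofBijective _ hb, fun p : progression L M => ⟨k p, hpk p, rfl⟩⟩

/-- A non-atomic standard probability space has a partition into `n` cells of equal measure. -/
theorem exists_equipartition (μ : Measure X) [IsProbabilityMeasure μ] [NullSingletonClass μ]
    (n : ℕ) [NeZero n] : ∃ ξ : MeasPartition X (Fin n), ∀ i, μ.real (ξ.cell i) = 1 / n := by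
  -- In `X × Fin n` the second coordinate gives the equipartition, and this product is isomorphic to
  -- `X`.
  obtain ⟨e, he⟩ := exists_measurePreserving_equiv μ (μ.prod (unifFin n))
  have h : MeasurePreserving (Prod.snd ∘ e) μ (unifFin n) := measurePreserving_snd.comp he
  refine ⟨⟨fun i => (Prod.snd ∘ e) ⁻¹' {i}, fun i => h.measurable (measurableSet_singleton i),
    fun i j hij => (Set.disjoint_singleton.2 hij).preimage _, ?_⟩, fun i => ?_⟩
  · rw [← preimage_iUnion, iUnion_of_singleton, preimage_univ]
  · rw [Measure.real, h.measure_preimage (measurableSet_singleton i).nullMeasurableSet]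
    exact unifFin_singleton i

/-- Every automorphism is a limit of automorphisms for which, along a given sequence of
progressions, the translates of an equipartition are independent. -/
theorem exists_seq_tendsto {A : ℕ → Set X} (hA : IsDenseSeq μ A) {L : ℕ → ℕ}
    (hL : Tendsto L atTop atTop) {n : ℕ} [NeZero n] {ξ : MeasPartition X (Fin n)}
    (hξ : ∀ i, μ.real (ξ.cell i) = 1 / n) (S : Aut μ) :
    ∃ T : ℕ → Aut μ, Tendsto (fun M => halmosDist μ A (T M) S) atTop (𝓝 0) ∧
      ∀ᶠ M in atTop, meanEntropy μ (progression L M) ξ (T M) = Real.log n := by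
  obtain ⟨S, rfl⟩ := QuotientGroup.mk_surjective S
  -- `M` serves as the height of the tower, the step of the progression and the number of sets `A i`
  -- controlled. The finitely many `M` with `M = 0` or `L M = 0` receive the identity as a dummy
  -- value.
  have hex : ∀ M : ℕ, ∃ T : mpGroup μ, M ≠ 0 → L M ≠ 0 →
      (∀ i < M, imageDist μ (A i) (T : Aut μ) (S : Aut μ) ≤ 1 / M ∧
        imageDist μ (A i) (T : Aut μ)⁻¹ (S : Aut μ)⁻¹ ≤ 1 / M) ∧
      meanEntropy μ (progression L M) ξ (T : Aut μ) = Real.log n := by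
    intro M
    by_cases hM : M ≠ 0 ∧ L M ≠ 0
    · have : NeZero M := ⟨hM.1⟩
      have : NeZero (L M) := ⟨hM.2⟩
      obtain ⟨T, hT1, hT2⟩ := exists_approx S M (L M) (D := fun i : Fin M => A i)
        (fun i => hA.measurableSet i) ξ
      obtain ⟨β, hβ⟩ := exists_progression_equiv L M
      refine ⟨T, fun _ _ => ⟨fun i hi => hT1 ⟨i, hi⟩, meanEntropy_eq_log ?_ hξ (hT2 _ β hβ)⟩⟩
      rw [← Finset.card_pos, card_progression]
      exact NeZero.pos _
    · exact ⟨1, fun h1 h2 => absurd ⟨h1, h2⟩ hM⟩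
  choose T hT using hex
  have hev : ∀ᶠ M in atTop, M ≠ 0 ∧ L M ≠ 0 :=
    (eventually_ne_atTop 0).and (hL.eventually_ne_atTop 0)
  have hlim : Tendsto (fun M : ℕ => 1 / (M : ℝ)) atTop (𝓝 0) := tendsto_one_div_atTop_nhds_zero_nat
  refine ⟨fun M => (T M : Aut μ), tendsto_halmosDist (fun i => ?_) (fun i => ?_), ?_⟩
  · refine squeeze_zero' (Eventually.of_forall fun _ => imageDist_nonneg _ _ _ _) ?_ hlim
    filter_upwards [hev, eventually_gt_atTop i] with M hM hi
    exact ((hT M hM.1 hM.2).1 i hi).1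
  · refine squeeze_zero' (Eventually.of_forall fun _ => imageDist_nonneg _ _ _ _) ?_ hlim
    filter_upwards [hev, eventually_gt_atTop i] with M hM hi
    exact ((hT M hM.1 hM.2).1 i hi).2
  · filter_upwards [hev] with M hM
    exact (hT M hM.1 hM.2).2

end Approximation


/-! ### Genericity -/

section Genericity

variable {X : Type*} [MeasurableSpace X] {μ : Measure X}

theorem le_pEntropy_of_frequently {P : ℕ → Finset ℤ} {n : ℕ} {ξ : MeasPartition X (Fin n)}
    {c : ℝ} {S : Aut μ} (h : ∃ᶠ j in atTop, c < meanEntropy μ (P j) ξ S) :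
    (c : EReal) ≤ pEntropy μ P S := by
  refine le_trans ?_ (le_iSup₂ (f := fun (n : ℕ) (ξ : MeasPartition X (Fin n)) =>
    limsup (fun j => (meanEntropy μ (P j) ξ S : EReal)) atTop) n ξ)
  exact le_limsup_of_frequently_le (h.mono fun j hj => EReal.coe_le_coe_iff.2 hj.le)

variable [StandardBorelSpace X] [IsProbabilityMeasure μ]

theorem isOpen_lt_meanEntropy {A : ℕ → Set X} (hA : IsDenseSeq μ A) (F : Finset ℤ) {n : ℕ}
    (ξ : MeasPartition X (Fin n)) (c : ℝ) :
    letI : MetricSpace (Aut μ) := halmosMetric μ A hA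
    IsOpen {S : Aut μ | c < meanEntropy μ F ξ S} := by
  let _ : MetricSpace (Aut μ) := halmosMetric μ A hA
  refine isOpen_lt continuous_const (continuous_iff_continuousAt.2 fun S => ?_)
  have h : Tendsto (fun T : Aut μ => halmosDist μ A T S) (𝓝 S) (𝓝 0) :=
    tendsto_iff_dist_tendsto_zero.1 tendsto_id
  exact tendsto_meanEntropy hA h F ξ

variable [NullSingletonClass μ]

theorem dense_exists_lt_meanEntropy {A : ℕ → Set X} (hA : IsDenseSeq μ A) {L : ℕ → ℕ}
    (hL : Tendsto L atTop atTop) {n : ℕ} [NeZero n] {ξ : MeasPartition X (Fin n)}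
    (hξ : ∀ i, μ.real (ξ.cell i) = 1 / n) {c : ℝ} (hc : c < Real.log n) (N : ℕ) :
    letI : MetricSpace (Aut μ) := halmosMetric μ A hA
    Dense (⋃ j ≥ N, {S : Aut μ | c < meanEntropy μ (progression L j) ξ S}) := by
  let _ : MetricSpace (Aut μ) := halmosMetric μ A hA
  intro S
  obtain ⟨T, hT, hTe⟩ := exists_seq_tendsto hA hL hξ S
  refine mem_closure_of_tendsto (tendsto_iff_dist_tendsto_zero.2 hT) ?_
  filter_upwards [hTe, eventually_ge_atTop N] with M hM hMN
  exact mem_iUnion₂.2 ⟨M, hMN, show c < _ by rwa [hM]⟩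

end Genericity

end KushnirenkoEntropy

end

theorem mainTheorem2 {X : Type*} [MeasurableSpace X] [StandardBorelSpace X]
    (μ : Measure X) [IsProbabilityMeasure μ] [NullSingletonClass μ]
    (A : ℕ → Set X) (hA : KushnirenkoEntropy.IsDenseSeq μ A)
    (L : ℕ → ℕ) (hL : Tendsto L atTop atTop) :
    letI : MetricSpace (KushnirenkoEntropy.Aut μ) := KushnirenkoEntropy.halmosMetric μ A hA
    KushnirenkoEntropy.IsGeneric
      {S : KushnirenkoEntropy.Aut μ |
        KushnirenkoEntropy.pEntropy μ (KushnirenkoEntropy.progression L) S = ⊤} := by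
  open KushnirenkoEntropy in
  let _ : MetricSpace (Aut μ) := halmosMetric μ A hA
  have := completeSpace_halmosMetric A hA
  have hξ : ∀ c : ℕ, ∃ (n : ℕ) (_ : NeZero n) (ξ : MeasPartition X (Fin n)),
      (c : ℝ) < Real.log n ∧ ∀ i, μ.real (ξ.cell i) = 1 / n := by
    intro c
    obtain ⟨n, hn, hn0⟩ := (((Real.tendsto_log_atTop.comp
      tendsto_natCast_atTop_atTop).eventually_gt_atTop (c : ℝ)).and (eventually_ne_atTop 0)).exists
    have : NeZero n := ⟨hn0⟩
    obtain ⟨ξ, hξ⟩ := exists_equipartition μ n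
    exact ⟨n, this, ξ, hn, hξ⟩
  choose n hn ξ hlog hξ using hξ
  -- The index is `(c, N)`: membership for all `N` gives infinitely many `j` with mean entropy above
  -- `c`, as the upper limit requires, and `c` is then unbounded.
  let U : ℕ × ℕ → Set (Aut μ) := fun q =>
    ⋃ j ≥ q.2, {S : Aut μ | (q.1 : ℝ) < meanEntropy μ (progression L j) (ξ q.1) S}
  have hU : ∀ q, IsOpen (U q) := fun q =>
    isOpen_biUnion fun j _ => isOpen_lt_meanEntropy hA (progression L j) (ξ q.1) q.1
  refine ⟨⋂ q, U q, fun S hS => ?_, IsGδ.iInter_of_isOpen hU, dense_iInter_of_isOpen hU fun q =>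
    dense_exists_lt_meanEntropy hA hL (hξ q.1) (hlog q.1) q.2⟩
  have hle : ∀ c : ℕ, ((c : ℝ) : EReal) ≤ pEntropy μ (progression L) S := fun c => by
    refine le_pEntropy_of_frequently (ξ := ξ c) (frequently_atTop.2 fun N => ?_)
    obtain ⟨j, hj, hjS⟩ := mem_iUnion₂.1 (mem_iInter.1 hS (c, N))
    exact ⟨j, hj, hjS⟩
  refine EReal.eq_top_iff_forall_lt _ |>.2 fun y => ?_
  obtain ⟨c, hc⟩ := exists_nat_gt y
  exact (EReal.coe_lt_coe_iff.2 hc).trans_le (hle c)
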